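/- **Setting.** Let $\mathcal M$ be a strict 2-category (the mode theory); its objects $m,n,o$ are modes, its 1-cells $\mu:m\to n$ modalities, $\mathbb 1$ is the identity modality, and $\star$ denotes horizontal composition of 2-cells. *Contexts.* Scoping contexts at a mode are generated by: $\cdot$ at every mode; for $\hat\Gamma$ at $n$ and $\mu:m\to n$, the locked context $\hat\Gamma.\mathsf{L}_\mu$ at $m$ and the context $\hat\Gamma.\mu$ at $n$ (adding a variable). A lock telescope $\Lambda: n\to m$ is a composable list $\mathsf{L}_{\mu_1}\cdots \mathsf{L}_{\mu_k}$ with $\mathsf{locks}(\Lambda)=\mu_1\circ\dots\circ\mu_k:n\to m$ ($\mathbb 1$ if $k=0$); $\hat\Gamma.\Lambda$ is at $n$ for $\hat\Gamma$ at $m$, and telescopes are concatenated as $\Lambda.\Theta$. *WSMTT.* Expressions (in a scoping context $\hat\Gamma$) and substitutions $\hat\Gamma\to\hat\Delta$ (both contexts at the same mode) are defined mutually inductively. Expressions in $\hat\Gamma$ at $n$, for $\mu:m\to n$: $\mathsf{Bool},\mathsf{true},\mathsf{false}$; $\mathsf{if}(A;s;t;t')$ with $A$ in $\hat\Gamma.\mathbb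 1$ and $s,t,t'$ in $\hat\Gamma$; $(\mu\mid T)\to S$ with $T$ in $\hat\Gamma.\mathsf{L}_\mu$, $S$ in $\hat\Gamma.\mu$; $\lambda^\mu t$ with $t$ in $\hat\Gamma.\mu$; $\mathsf{app}_\mu(f;t)$ with $f$ in $\hat\Gamma$, $t$ in $\hat\Gamma.\mathsf{L}_\mu$; $\langle\mu\mid A\rangle$ and $\mathsf{mod}_\mu(t)$ with $A,t$ in $\hat\Gamma.\mathsf{L}_\mu$; for $\nu:n\to o$, $\mu:m\to n$ and $\hat\Gamma$ at $o$, $\mathsf{letmod}_{\nu,\mu}(A;B;t;s)$ with $A$ in $\hat\Gamma.\mathsf{L}_\nu.\mathsf{L}_\mu$, $B$ in $\hat\Gamma.\nu$, $t$ in $\hat\Gamma.\mathsf{L}_\nu$, $s$ in $\hat\Gamma.(\nu\circ\mu)$; moreover $\mathsf v_0$ in $\hat\Gamma.\mu.\mathsf{L}_\mu$; and $t[\sigma]$ in $\hat\Gamma$ for $t$ in $\hat\Delta$, $\sigma:\hat\Gamma\to\hat\Delta$. Substitutions: $!:\hat\Gamma\to\cdot$; $\mathsf{id}$; $\pi:\hat\Gamma.\mu\to\hat\Gamma$;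 $\sigma\circ\tau$; $\sigma.\mathsf{L}_\mu:\hat\Gamma.\mathsf{L}_\mu\to\hat\Delta.\mathsf{L}_\mu$ for $\sigma:\hat\Gamma\to\hat\Delta$; the key $\mathsf{K}^{\alpha}_{\Theta,\Psi,\hat\Gamma}:\hat\Gamma.\Psi\to\hat\Gamma.\Theta$ for a 2-cell $\alpha:\mathsf{locks}(\Theta)\Rightarrow\mathsf{locks}(\Psi)$; $\sigma.t:\hat\Gamma\to\hat\Delta.\mu$ for $\sigma:\hat\Gamma\to\hat\Delta$ and $t$ in $\hat\Gamma.\mathsf{L}_\mu$. Put $\sigma^+=(\sigma\circ\pi).\mathsf v_0$, and let $\sigma.\Lambda$ be $\sigma$ with all locks of $\Lambda$ applied. *$\sigma$-equivalence* $\equiv$ of WSMTT expressions and of substitutions (with the same contexts) is the least pair of congruences (equivalence relations preserved by all expression and substitution constructors) such that: $\circ$ is associative with unit $\mathsf{id}$; $t[\mathsf{id}]\equiv t$ and $t[\sigma\circ\tau]\equiv t[\sigma][\tau]$; substitutions are pushed through every expression constructor except $\mathsf v_0$ and $t[\sigma]$, being changed to $\sigma.\mathsf{L}_\mu$ on an argument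 under a lock $\mathsf{L}_\mu$ and to $\sigma^+$ on an argument under a variable (e.g. $(\lambda^\mu t)[\sigma]\equiv\lambda^\mu(t[\sigma^+])$, $\mathsf{app}_\mu(f;t)[\sigma]\equiv\mathsf{app}_\mu(f[\sigma];t[\sigma.\mathsf{L}_\mu])$); $\sigma\equiv\,!$ for $\sigma:\hat\Gamma\to\cdot$; $\mathsf v_0[(\sigma.t).\mathsf{L}_\mu]\equiv t$; $\pi\circ(\sigma.t)\equiv\sigma$; $\sigma\equiv(\pi\circ\sigma).(\mathsf v_0[\sigma.\mathsf{L}_\mu])$ for $\sigma:\hat\Gamma\to\hat\Delta.\mu$; $\mathsf{id}.\mathsf{L}_\mu\equiv\mathsf{id}$ and $(\sigma\circ\tau).\mathsf{L}_\mu\equiv(\sigma.\mathsf{L}_\mu)\circ(\tau.\mathsf{L}_\mu)$; $\mathsf{K}^{\alpha}_{\Lambda,\Theta,\hat\Delta}\circ(\sigma.\Theta)\equiv(\sigma.\Lambda)\circ \mathsf{K}^{\alpha}_{\Lambda,\Theta,\hat\Gamma}$ for $\sigma:\hat\Gamma\to\hat\Delta$; $\mathsf{K}^{1}_{\Lambda,\Lambda,\hat\Gamma}\equiv\mathsf{id}$;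 $\mathsf{K}^{\beta\circ\alpha}_{\Lambda,\Psi,\hat\Gamma}\equiv\mathsf{K}^{\alpha}_{\Lambda,\Theta,\hat\Gamma}\circ\mathsf{K}^{\beta}_{\Theta,\Psi,\hat\Gamma}$; and $\mathsf{K}^{\beta\star\alpha}_{\Lambda_1.\Theta_1,\Lambda_2.\Theta_2,\hat\Gamma}\equiv(\mathsf{K}^{\beta}_{\Lambda_1,\Lambda_2,\hat\Gamma}.\Theta_1)\circ\mathsf{K}^{\alpha}_{\Theta_1,\Theta_2,\hat\Gamma.\Lambda_2}$. *SFMTT.* Variables are generated by $\mathsf v_0^\alpha$ in $\hat\Gamma.\mu.\Theta$ for $\alpha:\mu\Rightarrow\mathsf{locks}(\Theta)$, and $\mathsf{suc}(v)$ in $\hat\Gamma.\mu.\Theta$ for $v$ in $\hat\Gamma.\Theta$ ($\Theta$ a lock telescope). SFMTT expressions have the variables and the constructors of WSMTT expressions other than $\mathsf v_0$ and $t[\sigma]$. Atomic renamings (resp. atomic substitutions) $\hat\Gamma\to\hat\Delta$ are generated by $!$, $\mathsf{id}^{\mathsf a}$, $\mathsf{weaken}(\sigma):\hat\Gamma.\mu\to\hat\Delta$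 for $\sigma:\hat\Gamma\to\hat\Delta$, $\sigma.\mathsf{L}_\mu$, keys, and $\sigma.w:\hat\Gamma\to\hat\Delta.\mu$ with $w$ a variable (resp. an expression) in $\hat\Gamma.\mathsf{L}_\mu$. Put $\pi=\mathsf{weaken}(\mathsf{id}^{\mathsf a})$ and $\sigma^+=\mathsf{weaken}(\sigma).\mathsf v_0^{1_\mu}$. A (regular) SFMTT substitution is a finite composable sequence of atomic substitutions; $\mathsf{id}$ is the empty sequence, $\sigma\circledcirc\tau$ appends the atomic substitution $\tau$, $\mathbin{+\!\!+}$ is concatenation, and $\sigma^+$ and $\sigma.\mathsf{L}_\mu$ act on each member. *Application.* An atomic renaming or substitution is pushed through all non-variable constructors, becoming $\sigma.\mathsf{L}_\mu$ on arguments under $\mathsf{L}_\mu$ and $\sigma^+$ on arguments under a variable. For a 2-cell $\alpha:\mathsf{locks}(\Theta)\Rightarrow\mathsf{locks}(\Psi)$, the operation $v\mapsto v\{\alpha\}^\Theta_\Psi$ from variables of $\hat\Gamma.\Theta$ to variables of $\hat\Gamma.\Psi$ is given by $\mathsf v_0^\beta\{\alpha\}=\mathsf v_0^{(1_{\mathsf{locks}(\Lambda)}\star\alpha)\circ\beta}$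 (where $\hat\Gamma=\hat\Gamma'.\mu.\Lambda$, and the variable lies in $\hat\Gamma'.\mu.\Lambda.\Theta$) and $\mathsf{suc}(v)\{\alpha\}=\mathsf{suc}(v\{\alpha\})$. A renaming $\sigma:\hat\Gamma\to\hat\Delta$ sends a variable $v$ of $\hat\Delta.\Lambda$ to a variable $v[\sigma]^\Lambda$ of $\hat\Gamma.\Lambda$: $v[\mathsf{id}^{\mathsf a}]^\Lambda=v$; $v[\mathsf{weaken}(\sigma)]^\Lambda=\mathsf{suc}(v[\sigma]^\Lambda)$; $v[\sigma.\mathsf{L}_\mu]^\Lambda=v[\sigma]^{\mathsf{L}_\mu.\Lambda}$; $v[\mathsf{K}^\beta_{\Theta,\Psi,\hat\Gamma}]^\Lambda=v\{\beta\star1_{\mathsf{locks}(\Lambda)}\}^{\Theta.\Lambda}_{\Psi.\Lambda}$; $\mathsf v_0^\alpha[\sigma.w]^\Lambda=w\{\alpha\}^{\mathsf{L}_\mu}_\Lambda$; $\mathsf{suc}(v)[\sigma.w]^\Lambda=v[\sigma]^\Lambda$. For atomic substitutions, with values expressions of $\hat\Gamma.\Lambda$, the clauses are the same except $v[\mathsf{weaken}(\sigma)]^\Lambda=(v[\sigma]^\Lambda)[\pi.\Lambda]$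 and $\mathsf v_0^\alpha[\sigma.t]^\Lambda=t[\mathsf{K}^\alpha_{\mathsf{L}_\mu,\Lambda,\hat\Gamma}]$, where the right-hand sides apply renamings. (No clause is needed for $!$, as $\cdot.\Lambda$ has no variables.) On expressions, variables are treated with $\Lambda$ empty. A regular substitution applies its atomic members one after the other: $t[\mathsf{id}]=t$, $t[\sigma\circledcirc\tau]=t[\sigma][\tau]$. *Translation.* $\llbracket-\rrbracket$ from WSMTT to SFMTT commutes with all common expression constructors, and $\llbracket\mathsf v_0\rrbracket=\mathsf v_0^{1_\mu}$, $\llbracket t[\sigma]\rrbracket=\llbracket t\rrbracket[\llbracket\sigma\rrbracket]$ (substitution computed), $\llbracket !\rrbracket=\mathsf{id}\circledcirc\,!$, $\llbracket\mathsf{id}\rrbracket=\mathsf{id}$, $\llbracket\pi\rrbracket=\mathsf{id}\circledcirc\pi$, $\llbracket\sigma\circ\tau\rrbracket=\llbracket\sigma\rrbracket\mathbin{+\!\!+}\llbracket\tau\rrbracket$, $\llbracket\sigma.\mathsf{L}_\mu\rrbracket=\llbracket\sigma\rrbracket.\mathsf{L}_\mu$, $\llbracket\mathsf{K}^\alpha_{\Theta,\Psi,\hat\Gamma}\rrbracket=\mathsf{id}\circledcirc\mathsf{K}^\alpha_{\Theta,\Psi,\hat\Gamma}$,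 $\llbracket\sigma.t\rrbracket=\llbracket\sigma\rrbracket^+\circledcirc(\mathsf{id}^{\mathsf a}.\llbracket t\rrbracket)$. Two SFMTT substitutions $\sigma,\tau:\hat\Gamma\to\hat\Delta$ are *observationally equivalent* if $t[\sigma]=t[\tau]$ for every SFMTT expression $t$ in $\hat\Delta$. **Theorem (Completeness).** For all WSMTT expressions $t,s$ in a scoping context $\hat\Gamma$, if $t\equiv s$ then $\llbracket t\rrbracket=\llbracket s\rrbracket$ (syntactic equality). For all WSMTT substitutions $\sigma,\tau:\hat\Gamma\to\hat\Delta$, if $\sigma\equiv\tau$ then $\llbracket\sigma\rrbracket$ and $\llbracket\tau\rrbracket$ are observationally equivalent. -/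

import Mathlib

/-!
Mode theory: a strict 2-category `M` (a bicategory with `Bicategory.Strict`). Objects are modes,
1-cells `μ : m ⟶ n` are modalities, 2-cells are `α : μ ⟶ ν`. Mathlib composes in diagrammatic order:
the modality usually written `ν ∘ μ` is `μ ≫ ν`, and the vertical composite `β ∘ α` is `α ≫ β`.
Associativity and unit laws of 1-cells hold as equations; `eqToHom` transports 2-cells along them.
-/

open CategoryTheory

universe w v u

namespace MTT

section

variable {M : Type u} [Bicategory.{w, v} M]

/-! ### Scoping contexts and lock telescopes -/

/-- Scoping contexts at a mode: `·`, `Γ.🔒μ` and `Γ, μ`. -/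
inductive SCtx : M → Type (max u v)
  | empty {m : M} : SCtx m
  | lock {m n : M} (Γ : SCtx n) (μ : m ⟶ n) : SCtx m
  | ext {m n : M} (Γ : SCtx n) (μ : m ⟶ n) : SCtx n

/-- Lock telescopes: composable lists of locks. They are generated here by adding a lock on the
left, `cons μ Λ = 🔒μ.Λ`; adding a lock on the right is `LockTele.snoc`. -/
inductive LockTele (m : M) : M → Type (max u v)
  | nil : LockTele m m
  | cons {n o : M} (μ : n ⟶ o) (Λ : LockTele m n) : LockTele m o

namespace LockTele

/-- The telescope consisting of a single lock. -/
def single {m n : M} (μ : m ⟶ n) : LockTele m n := cons μ nil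

/-- Concatenation `Λ.Θ`. -/
def append {k m : M} : {n : M} → LockTele m n → LockTele k m → LockTele k n
  | _, nil, Θ => Θ
  | _, cons μ Λ, Θ => cons μ (append Λ Θ)

/-- The telescope `Λ.🔒μ`. -/
def snoc {k m n : M} (Λ : LockTele m n) (μ : k ⟶ m) : LockTele k n := Λ.append (single μ)

/-- The composite modality of a lock telescope. -/
def locks {m : M} : {n : M} → LockTele m n → (m ⟶ n)
  | _, nil => 𝟙 m
  | _, cons μ Λ => locks Λ ≫ μ

end LockTele

/-- `Γ.Λ`: a scoping context extended with a lock telescope. -/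
def SCtx.addLocks {m : M} : {n : M} → SCtx n → LockTele m n → SCtx m
  | _, Γ, .nil => Γ
  | _, Γ, .cons μ Λ => (Γ.lock μ).addLocks Λ

theorem SCtx.addLocks_append {k m : M} : {n : M} → (Γ : SCtx n) → (Λ : LockTele m n) →
    (Θ : LockTele k m) → Γ.addLocks (Λ.append Θ) = (Γ.addLocks Λ).addLocks Θ
  | _, _, .nil, _ => rfl
  | _, Γ, .cons μ Λ, Θ => SCtx.addLocks_append (Γ.lock μ) Λ Θ

theorem SCtx.addLocks_snoc {k m n : M} (Γ : SCtx n) (Λ : LockTele m n) (μ : k ⟶ m) :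
    Γ.addLocks (Λ.snoc μ) = (Γ.addLocks Λ).lock μ :=
  Γ.addLocks_append Λ (.single μ)

namespace LockTele

variable [Bicategory.Strict M]

theorem locks_single {m n : M} (μ : m ⟶ n) : (single μ).locks = μ :=
  Bicategory.Strict.id_comp μ

theorem locks_append {k m : M} : {n : M} → (Λ : LockTele m n) → (Θ : LockTele k m) →
    (Λ.append Θ).locks = Θ.locks ≫ Λ.locks
  | _, nil, Θ => (Bicategory.Strict.comp_id Θ.locks).symm
  | _, cons μ Λ, Θ => by
    simp only [append, locks, locks_append Λ Θ, Bicategory.Strict.assoc]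

theorem locks_snoc {k m n : M} (Λ : LockTele m n) (μ : k ⟶ m) :
    (Λ.snoc μ).locks = μ ≫ Λ.locks := by
  rw [snoc, locks_append, locks_single]

open Bicategory in
/-- The horizontal composite `β ⋆ α : locks (Λ₁.Θ₁) ⇒ locks (Λ₂.Θ₂)` of `β : locks Λ₁ ⇒ locks Λ₂`
and `α : locks Θ₁ ⇒ locks Θ₂`. -/
def hcomp {k m n : M} {Λ₁ Λ₂ : LockTele m n} {Θ₁ Θ₂ : LockTele k m}
    (β : Λ₁.locks ⟶ Λ₂.locks) (α : Θ₁.locks ⟶ Θ₂.locks) :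
    (Λ₁.append Θ₁).locks ⟶ (Λ₂.append Θ₂).locks :=
  eqToHom (locks_append Λ₁ Θ₁) ≫ (α ▷ Λ₁.locks ≫ Θ₂.locks ◁ β) ≫
    eqToHom (locks_append Λ₂ Θ₂).symm

/-- A 2-cell out of `μ`, as a 2-cell out of `locks (🔒μ) = μ`. -/
def fromSingle {m n : M} {μ : m ⟶ n} {Λ : LockTele m n} (α : μ ⟶ Λ.locks) :
    (single μ).locks ⟶ Λ.locks :=
  eqToHom (locks_single μ) ≫ α

end LockTele

/-! ### WSMTT: well-scoped multimode type theory with explicit substitutions -/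

mutual

/-- WSMTT expressions in a scoping context. -/
inductive WExpr : {m : M} → SCtx m → Type (max u v w)
  | arrow {m n : M} {Γ : SCtx n} (μ : m ⟶ n) (T : WExpr (Γ.lock μ)) (S : WExpr (Γ.ext μ)) : WExpr Γ
  | lam {m n : M} {Γ : SCtx n} (μ : m ⟶ n) (t : WExpr (Γ.ext μ)) : WExpr Γ
  | app {m n : M} {Γ : SCtx n} (μ : m ⟶ n) (f : WExpr Γ) (t : WExpr (Γ.lock μ)) : WExpr Γ
  | vzero {m n : M} {Γ : SCtx n} {μ : m ⟶ n} : WExpr ((Γ.ext μ).lock μ)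
  | sub {m : M} {Γ Δ : SCtx m} (t : WExpr Δ) (σ : WSub Γ Δ) : WExpr Γ
  | bool {m : M} {Γ : SCtx m} : WExpr Γ
  | tt {m : M} {Γ : SCtx m} : WExpr Γ
  | ff {m : M} {Γ : SCtx m} : WExpr Γ
  | ite {m : M} {Γ : SCtx m} (A : WExpr (Γ.ext (𝟙 m))) (s t t' : WExpr Γ) : WExpr Γ
  | modTy {m n : M} {Γ : SCtx n} (μ : m ⟶ n) (A : WExpr (Γ.lock μ)) : WExpr Γ
  | modTm {m n : M} {Γ : SCtx n} (μ : m ⟶ n) (t : WExpr (Γ.lock μ)) : WExpr Γ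
  | letMod {m n o : M} {Γ : SCtx o} (ν : n ⟶ o) (μ : m ⟶ n) (A : WExpr ((Γ.lock ν).lock μ))
      (B : WExpr (Γ.ext ν)) (t : WExpr (Γ.lock ν)) (s : WExpr (Γ.ext (μ ≫ ν))) : WExpr Γ

/-- WSMTT substitutions; `WSub Γ Δ` are the substitutions from `Γ` to `Δ`. -/
inductive WSub : {m : M} → SCtx m → SCtx m → Type (max u v w)
  | bang {m : M} {Γ : SCtx m} : WSub Γ .empty
  | id {m : M} {Γ : SCtx m} : WSub Γ Γ
  | pi {m n : M} {Γ : SCtx n} {μ : m ⟶ n} : WSub (Γ.ext μ) Γ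
  | comp {m : M} {Γ Δ Ξ : SCtx m} (σ : WSub Δ Ξ) (τ : WSub Γ Δ) : WSub Γ Ξ
  | lock {m n : M} {Γ Δ : SCtx n} (σ : WSub Γ Δ) (μ : m ⟶ n) : WSub (Γ.lock μ) (Δ.lock μ)
  | key {m n : M} (Γ : SCtx m) (Θ Ψ : LockTele n m) (α : Θ.locks ⟶ Ψ.locks) :
      WSub (Γ.addLocks Ψ) (Γ.addLocks Θ)
  | extend {m n : M} {Γ Δ : SCtx n} {μ : m ⟶ n} (σ : WSub Γ Δ) (t : WExpr (Γ.lock μ)) :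
      WSub Γ (Δ.ext μ)

end

/-- Lifting `σ⁺ = (σ ∘ π) . v₀`. -/
def WSub.lift {m n : M} {Γ Δ : SCtx n} (σ : WSub Γ Δ) (μ : m ⟶ n) : WSub (Γ.ext μ) (Δ.ext μ) :=
  .extend (.comp σ .pi) .vzero

/-- `σ.Λ`: all locks of a lock telescope applied to a substitution. -/
def WSub.addLocks {m : M} : {n : M} → {Γ Δ : SCtx n} → WSub Γ Δ → (Λ : LockTele m n) →
    WSub (Γ.addLocks Λ) (Δ.addLocks Λ)
  | _, _, _, σ, .nil => σ
  | _, _, _, σ, .cons μ Λ => (σ.lock μ).addLocks Λ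

/-- Transport of a substitution along equalities of scoping contexts. -/
def WSub.cast {m : M} {Γ Γ' Δ Δ' : SCtx m} (hΓ : Γ = Γ') (hΔ : Δ = Δ') (σ : WSub Γ Δ) :
    WSub Γ' Δ' :=
  hΔ ▸ hΓ ▸ σ

/-! ### σ-equivalence -/

variable [Bicategory.Strict M]

mutual

/-- σ-equivalence of WSMTT expressions. -/
inductive EqExpr : {m : M} → {Γ : SCtx m} → WExpr Γ → WExpr Γ → Prop
  -- equivalence relation
  | refl {m : M} {Γ : SCtx m} (t : WExpr Γ) : EqExpr t t
  | symm {m : M} {Γ : SCtx m} {t s : WExpr Γ} (h : EqExpr t s) : EqExpr s t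
  | trans {m : M} {Γ : SCtx m} {t s r : WExpr Γ} (h : EqExpr t s) (h' : EqExpr s r) : EqExpr t r
  -- functoriality of explicit substitution
  | sub_id {m : M} {Γ : SCtx m} (t : WExpr Γ) : EqExpr (t.sub .id) t
  | sub_comp {m : M} {Γ Δ Ξ : SCtx m} (t : WExpr Ξ) (σ : WSub Δ Ξ) (τ : WSub Γ Δ) :
      EqExpr (t.sub (σ.comp τ)) ((t.sub σ).sub τ)
  -- congruence
  | cong_arrow {m n : M} {Γ : SCtx n} (μ : m ⟶ n) {T₁ T₂ : WExpr (Γ.lock μ)}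
      {S₁ S₂ : WExpr (Γ.ext μ)} (hT : EqExpr T₁ T₂) (hS : EqExpr S₁ S₂) :
      EqExpr (.arrow μ T₁ S₁) (.arrow μ T₂ S₂)
  | cong_lam {m n : M} {Γ : SCtx n} (μ : m ⟶ n) {t₁ t₂ : WExpr (Γ.ext μ)} (h : EqExpr t₁ t₂) :
      EqExpr (.lam μ t₁) (.lam μ t₂)
  | cong_app {m n : M} {Γ : SCtx n} (μ : m ⟶ n) {f₁ f₂ : WExpr Γ} {t₁ t₂ : WExpr (Γ.lock μ)}
      (hf : EqExpr f₁ f₂) (ht : EqExpr t₁ t₂) : EqExpr (.app μ f₁ t₁) (.app μ f₂ t₂)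
  | cong_sub {m : M} {Γ Δ : SCtx m} {t₁ t₂ : WExpr Δ} {σ₁ σ₂ : WSub Γ Δ} (ht : EqExpr t₁ t₂)
      (hσ : EqSub σ₁ σ₂) : EqExpr (t₁.sub σ₁) (t₂.sub σ₂)
  | cong_ite {m : M} {Γ : SCtx m} {A₁ A₂ : WExpr (Γ.ext (𝟙 m))} {s₁ s₂ t₁ t₂ t₁' t₂' : WExpr Γ}
      (hA : EqExpr A₁ A₂) (hs : EqExpr s₁ s₂) (ht : EqExpr t₁ t₂) (ht' : EqExpr t₁' t₂') :
      EqExpr (.ite A₁ s₁ t₁ t₁') (.ite A₂ s₂ t₂ t₂')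
  | cong_modTy {m n : M} {Γ : SCtx n} (μ : m ⟶ n) {A₁ A₂ : WExpr (Γ.lock μ)} (h : EqExpr A₁ A₂) :
      EqExpr (.modTy μ A₁) (.modTy μ A₂)
  | cong_modTm {m n : M} {Γ : SCtx n} (μ : m ⟶ n) {t₁ t₂ : WExpr (Γ.lock μ)} (h : EqExpr t₁ t₂) :
      EqExpr (.modTm μ t₁) (.modTm μ t₂)
  | cong_letMod {m n o : M} {Γ : SCtx o} (ν : n ⟶ o) (μ : m ⟶ n)
      {A₁ A₂ : WExpr ((Γ.lock ν).lock μ)} {B₁ B₂ : WExpr (Γ.ext ν)} {t₁ t₂ : WExpr (Γ.lock ν)}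
      {s₁ s₂ : WExpr (Γ.ext (μ ≫ ν))} (hA : EqExpr A₁ A₂) (hB : EqExpr B₁ B₂) (ht : EqExpr t₁ t₂)
      (hs : EqExpr s₁ s₂) : EqExpr (.letMod ν μ A₁ B₁ t₁ s₁) (.letMod ν μ A₂ B₂ t₂ s₂)
  -- pushing substitutions through the expression constructors
  | arrow_sub {m n : M} {Γ Δ : SCtx n} (μ : m ⟶ n) (T : WExpr (Δ.lock μ)) (S : WExpr (Δ.ext μ))
      (σ : WSub Γ Δ) :
      EqExpr ((WExpr.arrow μ T S).sub σ) (.arrow μ (T.sub (σ.lock μ)) (S.sub (σ.lift μ)))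
  | lam_sub {m n : M} {Γ Δ : SCtx n} (μ : m ⟶ n) (t : WExpr (Δ.ext μ)) (σ : WSub Γ Δ) :
      EqExpr ((WExpr.lam μ t).sub σ) (.lam μ (t.sub (σ.lift μ)))
  | app_sub {m n : M} {Γ Δ : SCtx n} (μ : m ⟶ n) (f : WExpr Δ) (t : WExpr (Δ.lock μ))
      (σ : WSub Γ Δ) :
      EqExpr ((WExpr.app μ f t).sub σ) (.app μ (f.sub σ) (t.sub (σ.lock μ)))
  | bool_sub {m : M} {Γ Δ : SCtx m} (σ : WSub Γ Δ) : EqExpr (WExpr.bool.sub σ) .bool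
  | tt_sub {m : M} {Γ Δ : SCtx m} (σ : WSub Γ Δ) : EqExpr (WExpr.tt.sub σ) .tt
  | ff_sub {m : M} {Γ Δ : SCtx m} (σ : WSub Γ Δ) : EqExpr (WExpr.ff.sub σ) .ff
  | ite_sub {m : M} {Γ Δ : SCtx m} (A : WExpr (Δ.ext (𝟙 m))) (s t t' : WExpr Δ) (σ : WSub Γ Δ) :
      EqExpr ((WExpr.ite A s t t').sub σ)
        (.ite (A.sub (σ.lift (𝟙 m))) (s.sub σ) (t.sub σ) (t'.sub σ))
  | modTy_sub {m n : M} {Γ Δ : SCtx n} (μ : m ⟶ n) (A : WExpr (Δ.lock μ)) (σ : WSub Γ Δ) :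
      EqExpr ((WExpr.modTy μ A).sub σ) (.modTy μ (A.sub (σ.lock μ)))
  | modTm_sub {m n : M} {Γ Δ : SCtx n} (μ : m ⟶ n) (t : WExpr (Δ.lock μ)) (σ : WSub Γ Δ) :
      EqExpr ((WExpr.modTm μ t).sub σ) (.modTm μ (t.sub (σ.lock μ)))
  | letMod_sub {m n o : M} {Γ Δ : SCtx o} (ν : n ⟶ o) (μ : m ⟶ n)
      (A : WExpr ((Δ.lock ν).lock μ)) (B : WExpr (Δ.ext ν)) (t : WExpr (Δ.lock ν))
      (s : WExpr (Δ.ext (μ ≫ ν))) (σ : WSub Γ Δ) :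
      EqExpr ((WExpr.letMod ν μ A B t s).sub σ)
        (.letMod ν μ (A.sub ((σ.lock ν).lock μ)) (B.sub (σ.lift ν)) (t.sub (σ.lock ν))
          (s.sub (σ.lift (μ ≫ ν))))
  -- context extension
  | extend_var {m n : M} {Γ Δ : SCtx n} (μ : m ⟶ n) (σ : WSub Γ Δ) (t : WExpr (Γ.lock μ)) :
      EqExpr (WExpr.vzero.sub ((WSub.extend σ t).lock μ)) t

/-- σ-equivalence of WSMTT substitutions. -/
inductive EqSub : {m : M} → {Γ Δ : SCtx m} → WSub Γ Δ → WSub Γ Δ → Prop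
  -- equivalence relation
  | refl {m : M} {Γ Δ : SCtx m} (σ : WSub Γ Δ) : EqSub σ σ
  | symm {m : M} {Γ Δ : SCtx m} {σ τ : WSub Γ Δ} (h : EqSub σ τ) : EqSub τ σ
  | trans {m : M} {Γ Δ : SCtx m} {σ τ ρ : WSub Γ Δ} (h : EqSub σ τ) (h' : EqSub τ ρ) : EqSub σ ρ
  -- category laws
  | id_right {m : M} {Γ Δ : SCtx m} (σ : WSub Γ Δ) : EqSub (σ.comp .id) σ
  | id_left {m : M} {Γ Δ : SCtx m} (σ : WSub Γ Δ) : EqSub (WSub.id.comp σ) σ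
  | assoc {m : M} {Γ Δ Ξ Ω : SCtx m} (σ : WSub Ξ Ω) (τ : WSub Δ Ξ) (ρ : WSub Γ Δ) :
      EqSub ((σ.comp τ).comp ρ) (σ.comp (τ.comp ρ))
  -- congruence
  | cong_comp {m : M} {Γ Δ Ξ : SCtx m} {σ₁ σ₂ : WSub Δ Ξ} {τ₁ τ₂ : WSub Γ Δ} (hσ : EqSub σ₁ σ₂)
      (hτ : EqSub τ₁ τ₂) : EqSub (σ₁.comp τ₁) (σ₂.comp τ₂)
  | cong_extend {m n : M} {Γ Δ : SCtx n} (μ : m ⟶ n) {σ₁ σ₂ : WSub Γ Δ} {t₁ t₂ : WExpr (Γ.lock μ)}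
      (hσ : EqSub σ₁ σ₂) (ht : EqExpr t₁ t₂) :
      EqSub (WSub.extend σ₁ t₁ : WSub Γ (Δ.ext μ)) (WSub.extend σ₂ t₂)
  | cong_lock {m n : M} {Γ Δ : SCtx n} (μ : m ⟶ n) {σ₁ σ₂ : WSub Γ Δ} (h : EqSub σ₁ σ₂) :
      EqSub (σ₁.lock μ) (σ₂.lock μ)
  -- empty context and context extension
  | empty_unique {m : M} {Γ : SCtx m} (σ : WSub Γ .empty) : EqSub σ .bang
  | extend_weaken {m n : M} {Γ Δ : SCtx n} (μ : m ⟶ n) (σ : WSub Γ Δ) (t : WExpr (Γ.lock μ)) :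
      EqSub (WSub.pi.comp (WSub.extend σ t)) σ
  | extend_eta {m n : M} {Γ Δ : SCtx n} (μ : m ⟶ n) (σ : WSub Γ (Δ.ext μ)) :
      EqSub σ (.extend (WSub.pi.comp σ) (WExpr.vzero.sub (σ.lock μ)))
  -- functor laws for locks
  | lock_id {m n : M} {Γ : SCtx n} (μ : m ⟶ n) : EqSub ((WSub.id : WSub Γ Γ).lock μ) .id
  | lock_comp {m n : M} {Γ Δ Ξ : SCtx n} (μ : m ⟶ n) (σ : WSub Δ Ξ) (τ : WSub Γ Δ) :
      EqSub ((σ.comp τ).lock μ) ((σ.lock μ).comp (τ.lock μ))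
  -- laws for key substitutions
  | key_natural {m n : M} {Γ Δ : SCtx m} (Λ Θ : LockTele n m) (α : Λ.locks ⟶ Θ.locks)
      (σ : WSub Γ Δ) :
      EqSub ((WSub.key Δ Λ Θ α).comp (σ.addLocks Θ)) ((σ.addLocks Λ).comp (WSub.key Γ Λ Θ α))
  | key_unit {m n : M} (Γ : SCtx m) (Λ : LockTele n m) : EqSub (WSub.key Γ Λ Λ (𝟙 Λ.locks)) .id
  | key_vert {m n : M} (Γ : SCtx m) (Λ Θ Ψ : LockTele n m) (α : Λ.locks ⟶ Θ.locks)
      (β : Θ.locks ⟶ Ψ.locks) :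
      EqSub (WSub.key Γ Λ Ψ (α ≫ β)) ((WSub.key Γ Λ Θ α).comp (WSub.key Γ Θ Ψ β))
  | key_horiz {m n o : M} (Γ : SCtx m) (Θ₁ Θ₂ : LockTele o n) (Λ₁ Λ₂ : LockTele n m)
      (α : Θ₁.locks ⟶ Θ₂.locks) (β : Λ₁.locks ⟶ Λ₂.locks) :
      EqSub
        ((WSub.key Γ (Λ₁.append Θ₁) (Λ₂.append Θ₂) (LockTele.hcomp β α)).cast
          (Γ.addLocks_append Λ₂ Θ₂) (Γ.addLocks_append Λ₁ Θ₁))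
        (((WSub.key Γ Λ₁ Λ₂ β).addLocks Θ₁).comp (WSub.key (Γ.addLocks Λ₂) Θ₁ Θ₂ α))

end

end

/-! ### SFMTT: substitution-free multimode type theory -/

section

variable {M : Type u} [Bicategory.{w, v} M]

/-- `SFVar Γ Λ` is the type of SFMTT variables of the scoping context `Γ.Λ`, where the split of the
context is kept explicit: `lock` only moves the last lock of the left part into the right part
(see `SFVar.splitEquiv`), while `vzero` and `suc` are the two genuine ways to form variables, in
contexts `(Γ, μ).Λ`. -/
inductive SFVar : {m n : M} → SCtx n → LockTele m n → Type (max u v w)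
  | vzero {m n : M} {Γ : SCtx n} {μ : m ⟶ n} {Λ : LockTele m n} (α : μ ⟶ Λ.locks) :
      SFVar (Γ.ext μ) Λ
  | suc {m n o : M} {Γ : SCtx n} {μ : o ⟶ n} {Λ : LockTele m n} (x : SFVar Γ Λ) : SFVar (Γ.ext μ) Λ
  | lock {m n o : M} {Γ : SCtx o} {μ : n ⟶ o} {Λ : LockTele m n} (x : SFVar Γ (.cons μ Λ)) :
      SFVar (Γ.lock μ) Λ

namespace SFVar

/-- Inverse of the constructor `lock`. -/
def unlock {m n o : M} {Γ : SCtx o} {μ : n ⟶ o} {Λ : LockTele m n} :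
    SFVar (Γ.lock μ) Λ → SFVar Γ (.cons μ Λ)
  | lock x => x

/-- A variable of `Γ.(Θ.Λ)`, seen as a variable of `(Γ.Θ).Λ`. -/
def join {k m : M} {Λ : LockTele k m} : {n : M} → {Γ : SCtx n} → (Θ : LockTele m n) →
    SFVar Γ (Θ.append Λ) → SFVar (Γ.addLocks Θ) Λ
  | _, _, .nil, x => x
  | _, _, .cons _ Θ, x => join Θ (lock x)

/-- A variable of `(Γ.Θ).Λ`, seen as a variable of `Γ.(Θ.Λ)`. -/
def split {k m : M} {Λ : LockTele k m} : {n : M} → {Γ : SCtx n} → (Θ : LockTele m n) →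
    SFVar (Γ.addLocks Θ) Λ → SFVar Γ (Θ.append Λ)
  | _, _, .nil, x => x
  | _, _, .cons _ Θ, x => unlock (split Θ x)

/-- A variable of `Γ.Λ`, with the whole context as left part. -/
def flat {m : M} : {n : M} → {Γ : SCtx n} → (Λ : LockTele m n) → SFVar Γ Λ →
    SFVar (Γ.addLocks Λ) .nil
  | _, _, .nil, x => x
  | _, _, .cons _ Λ, x => flat Λ (lock x)

/-- Inverse of `flat`. -/
def unflat {m : M} : {n : M} → {Γ : SCtx n} → (Λ : LockTele m n) → SFVar (Γ.addLocks Λ) .nil →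
    SFVar Γ Λ
  | _, _, .nil, x => x
  | _, Γ, .cons μ Λ, x => unlock (unflat (Γ := Γ.lock μ) Λ x)

theorem unflat_flat {m : M} : {n : M} → {Γ : SCtx n} → (Λ : LockTele m n) → (x : SFVar Γ Λ) →
    unflat Λ (flat Λ x) = x
  | _, _, .nil, _ => rfl
  | _, _, .cons _ Λ, x => congrArg unlock (unflat_flat Λ (lock x))

theorem flat_unflat {m : M} : {n : M} → {Γ : SCtx n} → (Λ : LockTele m n) →
    (x : SFVar (Γ.addLocks Λ) .nil) → flat Λ (unflat Λ x) = x
  | _, _, .nil, _ => rfl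
  | _, Γ, .cons μ Λ, x => by
    have h : lock (unlock (unflat (Γ := Γ.lock μ) Λ x)) = unflat (Γ := Γ.lock μ) Λ x := by
      cases unflat (Γ := Γ.lock μ) Λ x; rfl
    exact (congrArg (flat Λ) h).trans (flat_unflat (Γ := Γ.lock μ) Λ x)

/-- Variables in the split presentation `Γ`, `Λ` are the variables of the context `Γ.Λ`. -/
def splitEquiv {m n : M} (Γ : SCtx n) (Λ : LockTele m n) :
    SFVar Γ Λ ≃ SFVar (Γ.addLocks Λ) .nil where
  toFun := flat Λ
  invFun := unflat Λ
  left_inv := unflat_flat Λ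
  right_inv := flat_unflat Λ

open Bicategory in
/-- Action of a 2-cell `α : locks Θ ⇒ locks Ψ` on a variable of `Γ.Θ`. If the variable is
`vzero β` below further locks `Λ` at the end of `Γ`, then `β` becomes `(1_{locks Λ} ⋆ α) ∘ β`: the
2-cell is whiskered with each lock that is passed. -/
def transf {m : M} : {n : M} → {Γ : SCtx n} → {Θ Ψ : LockTele m n} → (Θ.locks ⟶ Ψ.locks) →
    SFVar Γ Θ → SFVar Γ Ψ
  | _, _, _, _, α, vzero β => vzero (β ≫ α)
  | _, _, _, _, α, suc x => suc (transf α x)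
  | _, _, Θ, Ψ, α, lock (μ := μ) x =>
    lock (transf (Θ := .cons μ Θ) (Ψ := .cons μ Ψ) (α ▷ μ) x)

end SFVar

/-- SFMTT expressions in a scoping context. -/
inductive SFExpr : {m : M} → SCtx m → Type (max u v w)
  | var {m : M} {Γ : SCtx m} (x : SFVar Γ .nil) : SFExpr Γ
  | bool {m : M} {Γ : SCtx m} : SFExpr Γ
  | tt {m : M} {Γ : SCtx m} : SFExpr Γ
  | ff {m : M} {Γ : SCtx m} : SFExpr Γ
  | ite {m : M} {Γ : SCtx m} (A : SFExpr (Γ.ext (𝟙 m))) (s t t' : SFExpr Γ) : SFExpr Γ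
  | arrow {m n : M} {Γ : SCtx n} (μ : m ⟶ n) (A : SFExpr (Γ.lock μ)) (B : SFExpr (Γ.ext μ)) :
      SFExpr Γ
  | lam {m n : M} {Γ : SCtx n} (μ : m ⟶ n) (t : SFExpr (Γ.ext μ)) : SFExpr Γ
  | app {m n : M} {Γ : SCtx n} (μ : m ⟶ n) (f : SFExpr Γ) (t : SFExpr (Γ.lock μ)) : SFExpr Γ
  | modTy {m n : M} {Γ : SCtx n} (μ : m ⟶ n) (A : SFExpr (Γ.lock μ)) : SFExpr Γ
  | modTm {m n : M} {Γ : SCtx n} (μ : m ⟶ n) (t : SFExpr (Γ.lock μ)) : SFExpr Γ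
  | letMod {m n o : M} {Γ : SCtx o} (ν : n ⟶ o) (μ : m ⟶ n) (A : SFExpr ((Γ.lock ν).lock μ))
      (B : SFExpr (Γ.ext ν)) (t : SFExpr (Γ.lock ν)) (s : SFExpr (Γ.ext (μ ≫ ν))) : SFExpr Γ

/-! ### Atomic renamings and substitutions -/

/-- Atomic rensubs from `Γ` to `Δ`, where the family `T` provides the objects (variables for
renamings, expressions for substitutions) that may be used in an extension. -/
inductive ARenSub (T : (m : M) → SCtx m → Type (max u v w)) :
    {m : M} → SCtx m → SCtx m → Type (max u v w)
  | bang {m : M} {Γ : SCtx m} : ARenSub T Γ .empty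
  | id {m : M} {Γ : SCtx m} : ARenSub T Γ Γ
  | weaken {m n : M} {Γ Δ : SCtx n} {μ : m ⟶ n} (σ : ARenSub T Γ Δ) : ARenSub T (Γ.ext μ) Δ
  | lock {m n : M} {Γ Δ : SCtx n} (σ : ARenSub T Γ Δ) (μ : m ⟶ n) :
      ARenSub T (Γ.lock μ) (Δ.lock μ)
  | key {m n : M} (Γ : SCtx m) (Θ Ψ : LockTele n m) (α : Θ.locks ⟶ Ψ.locks) :
      ARenSub T (Γ.addLocks Ψ) (Γ.addLocks Θ)
  | extend {m n : M} {Γ Δ : SCtx n} {μ : m ⟶ n} (σ : ARenSub T Γ Δ) (t : T m (Γ.lock μ)) :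
      ARenSub T Γ (Δ.ext μ)

/-- Atomic renamings. -/
abbrev ARen {m : M} (Γ Δ : SCtx m) : Type (max u v w) := ARenSub (fun _ Γ => SFVar Γ .nil) Γ Δ

/-- Atomic substitutions. -/
abbrev ASub {m : M} (Γ Δ : SCtx m) : Type (max u v w) := ARenSub (fun _ Γ => SFExpr Γ) Γ Δ

namespace ARenSub

variable {T : (m : M) → SCtx m → Type (max u v w)}

/-- Weakening `π`. -/
def pi {m n : M} {Γ : SCtx n} {μ : m ⟶ n} : ARenSub T (Γ.ext μ) Γ := .weaken .id

/-- `σ.Λ`: all locks of a lock telescope applied to an atomic rensub. -/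
def addLocks {m : M} : {n : M} → {Γ Δ : SCtx n} → ARenSub T Γ Δ → (Λ : LockTele m n) →
    ARenSub T (Γ.addLocks Λ) (Δ.addLocks Λ)
  | _, _, _, σ, .nil => σ
  | _, _, _, σ, .cons μ Λ => (σ.lock μ).addLocks Λ

/-- Lifting `σ⁺ = weaken σ . z`, where `z` provides the most recent variable as an element of `T`. -/
def lift (z : ⦃m n : M⦄ → (Γ : SCtx n) → (μ : m ⟶ n) → T m ((Γ.ext μ).lock μ))
    {m n : M} {Γ Δ : SCtx n} (σ : ARenSub T Γ Δ) (μ : m ⟶ n) : ARenSub T (Γ.ext μ) (Δ.ext μ) :=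
  .extend (.weaken σ) (z Γ μ)

end ARenSub

/-- Applying an atomic rensub to an expression, given the action `act` on variables. -/
def SFExpr.traverse {T : (m : M) → SCtx m → Type (max u v w)}
    (z : ⦃m n : M⦄ → (Γ : SCtx n) → (μ : m ⟶ n) → T m ((Γ.ext μ).lock μ))
    (act : ⦃m : M⦄ → ⦃Γ Δ : SCtx m⦄ → SFVar Δ .nil → ARenSub T Γ Δ → SFExpr Γ) :
    {m : M} → {Γ Δ : SCtx m} → SFExpr Δ → ARenSub T Γ Δ → SFExpr Γ
  | _, _, _, var x, σ => act x σ
  | _, _, _, bool, _ => bool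
  | _, _, _, tt, _ => tt
  | _, _, _, ff, _ => ff
  | _, _, _, ite A s t t', σ =>
    ite (traverse z act A (σ.lift z (𝟙 _))) (traverse z act s σ) (traverse z act t σ)
      (traverse z act t' σ)
  | _, _, _, arrow μ A B, σ =>
    arrow μ (traverse z act A (σ.lock μ)) (traverse z act B (σ.lift z μ))
  | _, _, _, lam μ t, σ => lam μ (traverse z act t (σ.lift z μ))
  | _, _, _, app μ f t, σ => app μ (traverse z act f σ) (traverse z act t (σ.lock μ))
  | _, _, _, modTy μ A, σ => modTy μ (traverse z act A (σ.lock μ))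
  | _, _, _, modTm μ t, σ => modTm μ (traverse z act t (σ.lock μ))
  | _, _, _, letMod ν μ A B t s, σ =>
    letMod ν μ (traverse z act A ((σ.lock ν).lock μ)) (traverse z act B (σ.lift z ν))
      (traverse z act t (σ.lock ν)) (traverse z act s (σ.lift z (μ ≫ ν)))

variable [Bicategory.Strict M]

/-- The variable `vzero 1_μ` of the scoping context `(Γ, μ).🔒μ`. -/
def SFVar.zeroOne {m n : M} (Γ : SCtx n) (μ : m ⟶ n) : SFVar ((Γ.ext μ).lock μ) .nil :=
  .lock (.vzero (Λ := .single μ) (eqToHom (LockTele.locks_single μ).symm))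

/-- Action of an atomic renaming `σ` from `Γ` to `Δ` on a variable of `Δ.Λ`, with result in
`Γ.Λ`. -/
def SFVar.ren {k : M} : {m : M} → {Γ Δ : SCtx m} → ARen Γ Δ → (Λ : LockTele k m) → SFVar Δ Λ →
    SFVar Γ Λ
  | _, _, _, .id, _, x => x
  | _, _, _, .weaken σ, Λ, x => .suc (ren σ Λ x)
  | _, _, _, .lock σ μ, Λ, .lock x => .lock (ren σ (.cons μ Λ) x)
  | _, _, _, .key _ Θ Ψ β, Λ, x =>
    .join Ψ (.transf (LockTele.hcomp β (𝟙 Λ.locks)) (.split Θ x))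
  | _, _, _, .extend _ w, _, .vzero α => .transf (LockTele.fromSingle α) (.unlock w)
  | _, _, _, .extend σ _, Λ, .suc x => ren σ Λ x

/-- Action of an atomic renaming on an expression. -/
def SFExpr.ren {m : M} {Γ Δ : SCtx m} (t : SFExpr Δ) (σ : ARen Γ Δ) : SFExpr Γ :=
  t.traverse (fun _ _ Γ μ => .zeroOne Γ μ) (fun _ _ _ x σ => .var (x.ren σ .nil)) σ

/-- Action of an atomic substitution `σ` from `Γ` to `Δ` on a variable of `Δ.Λ`, with result in
`Γ.Λ`. -/
def SFVar.sub {k : M} : {m : M} → {Γ Δ : SCtx m} → ASub Γ Δ → (Λ : LockTele k m) → SFVar Δ Λ →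
    SFExpr (Γ.addLocks Λ)
  | _, _, _, .id, Λ, x => .var (.flat Λ x)
  | _, _, _, .weaken σ, Λ, x => (sub σ Λ x).ren (ARenSub.pi.addLocks Λ)
  | _, _, _, .lock σ μ, Λ, .lock x => sub σ (.cons μ Λ) x
  | _, _, _, .key _ Θ Ψ β, Λ, x =>
    .var (.flat Λ (.join Ψ (.transf (LockTele.hcomp β (𝟙 Λ.locks)) (.split Θ x))))
  | _, _, _, .extend (μ := μ) _ t, Λ, .vzero α =>
    t.ren (.key _ (.single μ) Λ (LockTele.fromSingle α))
  | _, _, _, .extend σ _, Λ, .suc x => sub σ Λ x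

/-- The case of an empty lock telescope: action of an atomic substitution on a variable of `Δ`. -/
def SFVar.sub₀ {m : M} {Γ Δ : SCtx m} (x : SFVar Δ .nil) (σ : ASub Γ Δ) : SFExpr Γ :=
  SFVar.sub (Γ := Γ) (Δ := Δ) σ (.nil : LockTele m m) x

/-- Action of an atomic substitution on an expression. -/
def SFExpr.asub {m : M} {Γ Δ : SCtx m} (t : SFExpr Δ) (σ : ASub Γ Δ) : SFExpr Γ :=
  t.traverse (fun _ _ Γ μ => .var (.zeroOne Γ μ)) (fun _ _ _ x σ => x.sub₀ σ) σ

/-! ### Regular substitutions -/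

/-- SFMTT substitutions: sequences of atomic substitutions. -/
inductive SFSub : {m : M} → SCtx m → SCtx m → Type (max u v w)
  | id {m : M} {Γ : SCtx m} : SFSub Γ Γ
  | snoc {m : M} {Γ Δ Ξ : SCtx m} (σ : SFSub Δ Ξ) (τ : ASub Γ Δ) : SFSub Γ Ξ

namespace SFSub

/-- The one-element sequence. -/
def atom {m : M} {Γ Δ : SCtx m} (τ : ASub Γ Δ) : SFSub Γ Δ := .snoc .id τ

/-- Concatenation. -/
def concat {m : M} {Γ Δ Ξ : SCtx m} (σ : SFSub Δ Ξ) : SFSub Γ Δ → SFSub Γ Ξ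
  | id => σ
  | snoc τ ρ => snoc (concat σ τ) ρ

/-- The lock operation, applied to every atomic substitution of a sequence. -/
def lock {m n : M} {Γ Δ : SCtx n} (σ : SFSub Γ Δ) (μ : m ⟶ n) : SFSub (Γ.lock μ) (Δ.lock μ) :=
  match σ with
  | id => id
  | snoc σ τ => snoc (lock σ μ) (τ.lock μ)

/-- Lifting, applied to every atomic substitution of a sequence. -/
def lift {m n : M} {Γ Δ : SCtx n} (σ : SFSub Γ Δ) (μ : m ⟶ n) : SFSub (Γ.ext μ) (Δ.ext μ) :=
  match σ with
  | id => id
  | snoc σ τ => snoc (lift σ μ) (τ.lift (fun _ _ Γ μ => .var (.zeroOne Γ μ)) μ)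

end SFSub

/-- Applying a substitution: its atomic substitutions are applied one after the other. -/
def SFExpr.sub {m : M} {Γ Δ : SCtx m} (t : SFExpr Δ) : SFSub Γ Δ → SFExpr Γ
  | .id => t
  | .snoc σ τ => (t.sub σ).asub τ

/-- Observational equivalence of SFMTT substitutions. -/
def ObsEq {m : M} {Γ Δ : SCtx m} (σ τ : SFSub Γ Δ) : Prop :=
  ∀ t : SFExpr Δ, t.sub σ = t.sub τ

/-! ### Translation from WSMTT to SFMTT -/

mutual

/-- Translation of expressions. -/
def WExpr.translate : {m : M} → {Γ : SCtx m} → WExpr Γ → SFExpr Γ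
  | _, _, .arrow μ T S => .arrow μ T.translate S.translate
  | _, _, .lam μ t => .lam μ t.translate
  | _, _, .app μ f t => .app μ f.translate t.translate
  | _, _, .vzero (Γ := Γ) (μ := μ) => .var (.zeroOne Γ μ)
  | _, _, .sub t σ => t.translate.sub σ.translate
  | _, _, .bool => .bool
  | _, _, .tt => .tt
  | _, _, .ff => .ff
  | _, _, .ite A s t t' => .ite A.translate s.translate t.translate t'.translate
  | _, _, .modTy μ A => .modTy μ A.translate
  | _, _, .modTm μ t => .modTm μ t.translate
  | _, _, .letMod ν μ A B t s =>
    .letMod ν μ A.translate B.translate t.translate s.translate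

/-- Translation of substitutions. -/
def WSub.translate : {m : M} → {Γ Δ : SCtx m} → WSub Γ Δ → SFSub Γ Δ
  | _, _, _, .bang => .atom .bang
  | _, _, _, .id => .id
  | _, _, _, .pi => .atom .pi
  | _, _, _, .comp σ τ => σ.translate.concat τ.translate
  | _, _, _, .lock σ μ => σ.translate.lock μ
  | _, _, _, .key Γ Θ Ψ α => .atom (.key Γ Θ Ψ α)
  | _, _, _, .extend (μ := μ) σ t => .snoc (σ.translate.lift μ) (.extend .id t.translate)

end

end

end MTT

/-!
The translation is shown to be sound for each rule of σ-equivalence. The difficulty is that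
applying a sequence of atomic substitutions to an expression is a recursion through binders and
locks, so that equations such as "weakening commutes with a lifted substitution" cannot be proved
directly: their induction steps involve lifts of lifts under arbitrary locks.

Every atomic renaming or substitution is therefore replaced by the family of maps it induces on
variables: a renaming from `Γ` to `Δ` becomes a map from the variables of `Δ.Λ` to those of `Γ.Λ`,
for every lock telescope `Λ` (`SRen`), and a substitution becomes such a map with values in the
expressions in `Γ.Λ` (`SSub`). These families can be locked, lifted and composed, they act on
expressions (`SFExpr.sren`, `SFExpr.ssub`), and two successive actions fuse into the action of the
composite: this is proved for renamings first, then for mixed pairs, then for substitutions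
(`SFExpr.ssub_ssub`). The syntactic operations agree with the functional ones
(`SFExpr.ren_eq_sren`, `SFExpr.asub_eq_ssub`, `SFExpr.sub_eq_ssub`), so an equation between
substitutions only has to be checked on variables.

The rules about keys rest on naturality: every family `σ` coming from syntax turns the action of a
2-cell on a variable into the action of a key on an expression (`SSub.isNatural_ofASub`). This gives
the naturality rule for keys (`SSub.IsNatural.ssub_key`), and also the rule of the substitution
calculus that instantiating the last variable commutes with substitution
(`SSub.IsNatural.lift_comp_extend`), because a variable `vzero α` is instantiated with a term acted
on by the key of `α`. From the latter follow the η-rule for context extension and the agreement of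
the two ways to lift a substitution (`WSub.ssub_translate_lift`). The rule for keys of horizontal
composites (`SRen.key_hcomp`) reduces to associativity of horizontal composition of 2-cells, up to
the identification of `Γ.(Θ.Λ)` with `(Γ.Θ).Λ`.

Finally, observational equivalence is a congruence for locks and lifts because the expression
constructors `mod` and `λ` are injective (`ObsEq.lock`, `ObsEq.lift`).
-/

namespace MTT

section

variable {M : Type u} [Bicategory.{w, v} M]

/-! ### Variables and lock telescopes -/

namespace SFVar

open scoped Bicategory

theorem transf_lock {m n o : M} {Γ : SCtx o} {μ : n ⟶ o} {Θ Ψ : LockTele m n}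
    (α : Θ.locks ⟶ Ψ.locks) (x : SFVar Γ (.cons μ Θ)) :
    transf α (lock x) = lock (transf (Θ := .cons μ Θ) (Ψ := .cons μ Ψ) (α ▷ μ) x) :=
  rfl

theorem transf_id {m : M} : {n : M} → {Γ : SCtx n} → {Θ : LockTele m n} → (x : SFVar Γ Θ) →
    transf (𝟙 Θ.locks) x = x
  | _, _, _, vzero β => by simp [transf]
  | _, _, _, suc x => by simp [transf, transf_id x]
  | _, _, _, lock (μ := μ) x => by
    rw [transf_lock, Bicategory.id_whiskerRight]
    exact congrArg lock (transf_id x)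

theorem transf_transf {m : M} : {n : M} → {Γ : SCtx n} → {Θ Ψ Φ : LockTele m n} →
    (α : Θ.locks ⟶ Ψ.locks) → (β : Ψ.locks ⟶ Φ.locks) → (x : SFVar Γ Θ) →
    transf β (transf α x) = transf (α ≫ β) x
  | _, _, _, _, _, α, β, vzero γ => by simp [transf]
  | _, _, _, _, _, α, β, suc x => by simp [transf, transf_transf α β x]
  | _, _, Θ, Ψ, Φ, α, β, lock (μ := μ) x => by
    rw [transf_lock, transf_lock, transf_lock, Bicategory.comp_whiskerRight]
    exact congrArg lock (transf_transf (Θ := .cons μ Θ) (Ψ := .cons μ Ψ) (Φ := .cons μ Φ) _ _ x)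

theorem lock_unlock {m n o : M} {Γ : SCtx o} {μ : n ⟶ o} {Λ : LockTele m n}
    (x : SFVar (Γ.lock μ) Λ) : lock x.unlock = x := by
  cases x; rfl

theorem split_join {k m : M} {Λ : LockTele k m} : {n : M} → {Γ : SCtx n} → (Θ : LockTele m n) →
    (x : SFVar Γ (Θ.append Λ)) → split Θ (join Θ x) = x
  | _, _, .nil, _ => rfl
  | _, _, .cons _ Θ, x => congrArg unlock (split_join Θ (lock x))

theorem join_split {k m : M} {Λ : LockTele k m} : {n : M} → {Γ : SCtx n} → (Θ : LockTele m n) →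
    (x : SFVar (Γ.addLocks Θ) Λ) → join Θ (split Θ x) = x
  | _, _, .nil, _ => rfl
  | _, Γ, .cons μ Θ, x =>
    (congrArg (join Θ) (lock_unlock _)).trans (join_split (Γ := Γ.lock μ) Θ x)

end SFVar

/-! ### Renamings and substitutions as functions -/

/-- Functional renamings from `Γ` to `Δ`: maps from the variables of `Δ.Λ` to those of `Γ.Λ`, for
every lock telescope `Λ`. -/
def SRen {m : M} (Γ Δ : SCtx m) : Type (max u v w) :=
  ∀ ⦃k : M⦄ (Λ : LockTele k m), SFVar Δ Λ → SFVar Γ Λ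

/-- Functional substitutions from `Γ` to `Δ`: maps from the variables of `Δ.Λ` to the expressions
in `Γ.Λ`, for every lock telescope `Λ`. -/
def SSub {m : M} (Γ Δ : SCtx m) : Type (max u v w) :=
  ∀ ⦃k : M⦄ (Λ : LockTele k m), SFVar Δ Λ → SFExpr (Γ.addLocks Λ)

namespace SRen

/-- Weakening by one variable. -/
def weak {m n : M} {Γ : SCtx n} {μ : m ⟶ n} : SRen (Γ.ext μ) Γ := fun _ _ x => .suc x

/-- A renaming under a lock, which joins the locks `Λ` on the right. -/
def lock {m n : M} {Γ Δ : SCtx n} (ρ : SRen Γ Δ) (μ : m ⟶ n) : SRen (Γ.lock μ) (Δ.lock μ) :=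
  fun _ Λ x => .lock (ρ (.cons μ Λ) x.unlock)

/-- A renaming under a variable, which is fixed. -/
def lift {m n : M} {Γ Δ : SCtx n} (ρ : SRen Γ Δ) (μ : m ⟶ n) : SRen (Γ.ext μ) (Δ.ext μ)
  | _, _, .vzero α => .vzero α
  | _, Λ, .suc x => .suc (ρ Λ x)

/-- `ρ.Λ`: a renaming under a lock telescope. -/
def addLocks {m : M} : {n : M} → {Γ Δ : SCtx n} → SRen Γ Δ → (Λ : LockTele m n) →
    SRen (Γ.addLocks Λ) (Δ.addLocks Λ)
  | _, _, _, ρ, .nil => ρ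
  | _, _, _, ρ, .cons μ Λ => (ρ.lock μ).addLocks Λ

/-- Composition, the renaming `ρ` being applied first. -/
def comp {m : M} {Γ Δ Ξ : SCtx m} (ρ : SRen Δ Ξ) (ρ' : SRen Γ Δ) : SRen Γ Ξ :=
  fun _ Λ x => ρ' Λ (ρ Λ x)

/-- The identity renaming between equal contexts. It takes the place of transports of expressions
along equalities of contexts. -/
def ofEq {m : M} {Γ Δ : SCtx m} (h : Γ = Δ) : SRen Γ Δ := fun _ _ x => h ▸ x

theorem lock_comp {m n : M} {Γ Δ Ξ : SCtx n} (ρ : SRen Δ Ξ) (ρ' : SRen Γ Δ) (μ : m ⟶ n) :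
    (ρ.comp ρ').lock μ = (ρ.lock μ).comp (ρ'.lock μ) :=
  rfl

theorem lift_comp {m n : M} {Γ Δ Ξ : SCtx n} (ρ : SRen Δ Ξ) (ρ' : SRen Γ Δ) (μ : m ⟶ n) :
    (ρ.comp ρ').lift μ = (ρ.lift μ).comp (ρ'.lift μ) := by
  funext k Λ x
  cases x <;> rfl

theorem addLocks_comp {m : M} : {n : M} → {Γ Δ Ξ : SCtx n} → (ρ : SRen Δ Ξ) → (ρ' : SRen Γ Δ) →
    (Λ : LockTele m n) → (ρ.comp ρ').addLocks Λ = (ρ.addLocks Λ).comp (ρ'.addLocks Λ)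
  | _, _, _, _, _, _, .nil => rfl
  | _, _, _, _, ρ, ρ', .cons μ Λ => addLocks_comp (ρ.lock μ) (ρ'.lock μ) Λ

theorem weak_comp_lift {m n : M} {Γ Δ : SCtx n} (ρ : SRen Γ Δ) (μ : m ⟶ n) :
    weak.comp (ρ.lift μ) = ρ.comp weak :=
  rfl

/-- Renamings commute with regrouping the locks of a context. -/
theorem addLocks_join {k m : M} {Λ : LockTele k m} : {n : M} → {Γ Δ : SCtx n} → (ρ : SRen Γ Δ) →
    (Θ : LockTele m n) → (x : SFVar Δ (Θ.append Λ)) →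
    ρ.addLocks Θ Λ (.join Θ x) = .join Θ (ρ (Θ.append Λ) x)
  | _, _, _, _, .nil, _ => rfl
  | _, _, _, ρ, .cons μ Θ, x => addLocks_join (ρ.lock μ) Θ (.lock x)

theorem addLocks_flat {m : M} : {n : M} → {Γ Δ : SCtx n} → (ρ : SRen Γ Δ) →
    (Θ : LockTele m n) → (x : SFVar Δ Θ) → ρ.addLocks Θ .nil (.flat Θ x) = .flat Θ (ρ Θ x)
  | _, _, _, _, .nil, _ => rfl
  | _, _, _, ρ, .cons μ Θ, x => addLocks_flat (ρ.lock μ) Θ (.lock x)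

end SRen

/-- Application of a functional renaming to an expression. -/
def SFExpr.sren : {m : M} → {Γ Δ : SCtx m} → SFExpr Δ → SRen Γ Δ → SFExpr Γ
  | _, _, _, var x, ρ => var (ρ .nil x)
  | _, _, _, bool, _ => bool
  | _, _, _, tt, _ => tt
  | _, _, _, ff, _ => ff
  | _, _, _, ite A s t t', ρ => ite (A.sren (ρ.lift (𝟙 _))) (s.sren ρ) (t.sren ρ) (t'.sren ρ)
  | _, _, _, arrow μ A B, ρ => arrow μ (A.sren (ρ.lock μ)) (B.sren (ρ.lift μ))
  | _, _, _, lam μ t, ρ => lam μ (t.sren (ρ.lift μ))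
  | _, _, _, app μ f t, ρ => app μ (f.sren ρ) (t.sren (ρ.lock μ))
  | _, _, _, modTy μ A, ρ => modTy μ (A.sren (ρ.lock μ))
  | _, _, _, modTm μ t, ρ => modTm μ (t.sren (ρ.lock μ))
  | _, _, _, letMod ν μ A B t s, ρ =>
    letMod ν μ (A.sren ((ρ.lock ν).lock μ)) (B.sren (ρ.lift ν)) (t.sren (ρ.lock ν))
      (s.sren (ρ.lift (μ ≫ ν)))

namespace SSub

/-- A renaming, seen as a substitution. -/
def ofRen {m : M} {Γ Δ : SCtx m} (ρ : SRen Γ Δ) : SSub Γ Δ := fun _ Λ x => .var (.flat Λ (ρ Λ x))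

/-- A substitution under a lock, which joins the locks `Λ` on the right. -/
def lock {m n : M} {Γ Δ : SCtx n} (σ : SSub Γ Δ) (μ : m ⟶ n) : SSub (Γ.lock μ) (Δ.lock μ) :=
  fun _ Λ x => σ (.cons μ Λ) x.unlock

/-- A substitution under a variable, which is fixed; the other values are weakened. -/
def lift {m n : M} {Γ Δ : SCtx n} (σ : SSub Γ Δ) (μ : m ⟶ n) : SSub (Γ.ext μ) (Δ.ext μ)
  | _, Λ, .vzero α => .var (.flat Λ (.vzero α))
  | _, Λ, .suc x => (σ Λ x).sren (SRen.weak.addLocks Λ)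

/-- `σ.Λ`: a substitution under a lock telescope. -/
def addLocks {m : M} : {n : M} → {Γ Δ : SCtx n} → SSub Γ Δ → (Λ : LockTele m n) →
    SSub (Γ.addLocks Λ) (Δ.addLocks Λ)
  | _, _, _, σ, .nil => σ
  | _, _, _, σ, .cons μ Λ => (σ.lock μ).addLocks Λ

/-- The renaming `ρ` followed by the substitution `σ`. -/
def renComp {m : M} {Γ Δ Ξ : SCtx m} (ρ : SRen Δ Ξ) (σ : SSub Γ Δ) : SSub Γ Ξ :=
  fun _ Λ x => σ Λ (ρ Λ x)

/-- The substitution `σ` followed by the renaming `ρ`. -/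
def compRen {m : M} {Γ Δ Ξ : SCtx m} (σ : SSub Δ Ξ) (ρ : SRen Γ Δ) : SSub Γ Ξ :=
  fun _ Λ x => (σ Λ x).sren (ρ.addLocks Λ)

end SSub

/-- Application of a functional substitution to an expression. -/
def SFExpr.ssub : {m : M} → {Γ Δ : SCtx m} → SFExpr Δ → SSub Γ Δ → SFExpr Γ
  | _, _, _, var x, σ => σ .nil x
  | _, _, _, bool, _ => bool
  | _, _, _, tt, _ => tt
  | _, _, _, ff, _ => ff
  | _, _, _, ite A s t t', σ => ite (A.ssub (σ.lift (𝟙 _))) (s.ssub σ) (t.ssub σ) (t'.ssub σ)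
  | _, _, _, arrow μ A B, σ => arrow μ (A.ssub (σ.lock μ)) (B.ssub (σ.lift μ))
  | _, _, _, lam μ t, σ => lam μ (t.ssub (σ.lift μ))
  | _, _, _, app μ f t, σ => app μ (f.ssub σ) (t.ssub (σ.lock μ))
  | _, _, _, modTy μ A, σ => modTy μ (A.ssub (σ.lock μ))
  | _, _, _, modTm μ t, σ => modTm μ (t.ssub (σ.lock μ))
  | _, _, _, letMod ν μ A B t s, σ =>
    letMod ν μ (A.ssub ((σ.lock ν).lock μ)) (B.ssub (σ.lift ν)) (t.ssub (σ.lock ν))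
      (s.ssub (σ.lift (μ ≫ ν)))

/-- The substitution `σ` followed by the substitution `τ`. -/
def SSub.comp {m : M} {Γ Δ Ξ : SCtx m} (σ : SSub Δ Ξ) (τ : SSub Γ Δ) : SSub Γ Ξ :=
  fun _ Λ x => (σ Λ x).ssub (τ.addLocks Λ)

/-! ### Fusion laws -/

namespace SFExpr

theorem sren_sren : {m : M} → {Γ Δ Ξ : SCtx m} → (t : SFExpr Ξ) → (ρ : SRen Δ Ξ) →
    (ρ' : SRen Γ Δ) → (t.sren ρ).sren ρ' = t.sren (ρ.comp ρ')
  | _, _, _, _, var _, _, _ => rfl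
  | _, _, _, _, bool, _, _ => rfl
  | _, _, _, _, tt, _, _ => rfl
  | _, _, _, _, ff, _, _ => rfl
  | _, _, _, _, ite A s t t', _, _ => by
    simp only [sren, sren_sren A, sren_sren s, sren_sren t, sren_sren t', SRen.lift_comp]
  | _, _, _, _, arrow _ A B, _, _ => by
    simp only [sren, sren_sren A, sren_sren B, SRen.lift_comp, SRen.lock_comp]
  | _, _, _, _, lam _ t, _, _ => by simp only [sren, sren_sren t, SRen.lift_comp]
  | _, _, _, _, app _ f t, _, _ => by
    simp only [sren, sren_sren f, sren_sren t, SRen.lock_comp]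
  | _, _, _, _, modTy _ A, _, _ => by simp only [sren, sren_sren A, SRen.lock_comp]
  | _, _, _, _, modTm _ t, _, _ => by simp only [sren, sren_sren t, SRen.lock_comp]
  | _, _, _, _, letMod _ _ A B t s, _, _ => by
    simp only [sren, sren_sren A, sren_sren B, sren_sren t, sren_sren s, SRen.lift_comp,
      SRen.lock_comp]

end SFExpr

namespace SSub

theorem lock_renComp {m n : M} {Γ Δ Ξ : SCtx n} (ρ : SRen Δ Ξ) (σ : SSub Γ Δ) (μ : m ⟶ n) :
    (renComp ρ σ).lock μ = renComp (ρ.lock μ) (σ.lock μ) :=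
  rfl

theorem lift_renComp {m n : M} {Γ Δ Ξ : SCtx n} (ρ : SRen Δ Ξ) (σ : SSub Γ Δ) (μ : m ⟶ n) :
    (renComp ρ σ).lift μ = renComp (ρ.lift μ) (σ.lift μ) := by
  funext k Λ x
  cases x <;> rfl

theorem addLocks_renComp {m : M} : {n : M} → {Γ Δ Ξ : SCtx n} → (ρ : SRen Δ Ξ) →
    (σ : SSub Γ Δ) → (Λ : LockTele m n) →
    (renComp ρ σ).addLocks Λ = renComp (ρ.addLocks Λ) (σ.addLocks Λ)
  | _, _, _, _, _, _, .nil => rfl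
  | _, _, _, _, ρ, σ, .cons μ Λ => addLocks_renComp (ρ.lock μ) (σ.lock μ) Λ

theorem lock_compRen {m n : M} {Γ Δ Ξ : SCtx n} (σ : SSub Δ Ξ) (ρ : SRen Γ Δ) (μ : m ⟶ n) :
    (compRen σ ρ).lock μ = compRen (σ.lock μ) (ρ.lock μ) :=
  rfl

theorem lift_compRen {m n : M} {Γ Δ Ξ : SCtx n} (σ : SSub Δ Ξ) (ρ : SRen Γ Δ) (μ : m ⟶ n) :
    (compRen σ ρ).lift μ = compRen (σ.lift μ) (ρ.lift μ) := by
  funext k Λ x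
  cases x with
  | vzero α => exact (congrArg SFExpr.var (SRen.addLocks_flat (ρ.lift μ) Λ (.vzero α))).symm
  | suc x =>
    change ((σ Λ x).sren _).sren _ = ((σ Λ x).sren _).sren _
    rw [SFExpr.sren_sren, SFExpr.sren_sren, ← SRen.addLocks_comp, ← SRen.addLocks_comp,
      SRen.weak_comp_lift]

theorem addLocks_compRen {m : M} : {n : M} → {Γ Δ Ξ : SCtx n} → (σ : SSub Δ Ξ) →
    (ρ : SRen Γ Δ) → (Λ : LockTele m n) →
    (compRen σ ρ).addLocks Λ = compRen (σ.addLocks Λ) (ρ.addLocks Λ)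
  | _, _, _, _, _, _, .nil => rfl
  | _, _, _, _, σ, ρ, .cons μ Λ => addLocks_compRen (σ.lock μ) (ρ.lock μ) Λ

theorem weak_renComp_lift {m n : M} {Γ Δ : SCtx n} (σ : SSub Γ Δ) (μ : m ⟶ n) :
    renComp .weak (σ.lift μ) = compRen σ .weak :=
  rfl

/-- Below locks `Θ`, a substitution acts on the flattened variables of `Δ.Θ` as it does on the split
ones. -/
theorem addLocks_flat {m : M} : {n : M} → {Γ Δ : SCtx n} → (σ : SSub Γ Δ) →
    (Θ : LockTele m n) → (x : SFVar Δ Θ) → σ.addLocks Θ .nil (.flat Θ x) = σ Θ x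
  | _, _, _, _, .nil, _ => rfl
  | _, _, _, σ, .cons μ Θ, x => addLocks_flat (σ.lock μ) Θ (.lock x)

theorem lock_ofRen {m n : M} {Γ Δ : SCtx n} (ρ : SRen Γ Δ) (μ : m ⟶ n) :
    (ofRen ρ).lock μ = ofRen (ρ.lock μ) :=
  rfl

theorem lift_ofRen {m n : M} {Γ Δ : SCtx n} (ρ : SRen Γ Δ) (μ : m ⟶ n) :
    (ofRen ρ).lift μ = ofRen (ρ.lift μ) := by
  funext k Λ x
  cases x with
  | vzero α => rfl
  | suc x => exact congrArg SFExpr.var (SRen.addLocks_flat _ Λ _)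

end SSub

namespace SFExpr

theorem sren_ssub : {m : M} → {Γ Δ Ξ : SCtx m} → (t : SFExpr Ξ) → (ρ : SRen Δ Ξ) →
    (σ : SSub Γ Δ) → (t.sren ρ).ssub σ = t.ssub (SSub.renComp ρ σ)
  | _, _, _, _, var _, _, _ => rfl
  | _, _, _, _, bool, _, _ => rfl
  | _, _, _, _, tt, _, _ => rfl
  | _, _, _, _, ff, _, _ => rfl
  | _, _, _, _, ite A s t t', _, _ => by
    simp only [sren, ssub, sren_ssub A, sren_ssub s, sren_ssub t, sren_ssub t', SSub.lift_renComp]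
  | _, _, _, _, arrow _ A B, _, _ => by
    simp only [sren, ssub, sren_ssub A, sren_ssub B, SSub.lift_renComp, SSub.lock_renComp]
  | _, _, _, _, lam _ t, _, _ => by simp only [sren, ssub, sren_ssub t, SSub.lift_renComp]
  | _, _, _, _, app _ f t, _, _ => by
    simp only [sren, ssub, sren_ssub f, sren_ssub t, SSub.lock_renComp]
  | _, _, _, _, modTy _ A, _, _ => by simp only [sren, ssub, sren_ssub A, SSub.lock_renComp]
  | _, _, _, _, modTm _ t, _, _ => by simp only [sren, ssub, sren_ssub t, SSub.lock_renComp]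
  | _, _, _, _, letMod _ _ A B t s, _, _ => by
    simp only [sren, ssub, sren_ssub A, sren_ssub B, sren_ssub t, sren_ssub s, SSub.lift_renComp,
      SSub.lock_renComp]

theorem ssub_sren : {m : M} → {Γ Δ Ξ : SCtx m} → (t : SFExpr Ξ) → (σ : SSub Δ Ξ) →
    (ρ : SRen Γ Δ) → (t.ssub σ).sren ρ = t.ssub (SSub.compRen σ ρ)
  | _, _, _, _, var _, _, _ => rfl
  | _, _, _, _, bool, _, _ => rfl
  | _, _, _, _, tt, _, _ => rfl
  | _, _, _, _, ff, _, _ => rfl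
  | _, _, _, _, ite A s t t', _, _ => by
    simp only [sren, ssub, ssub_sren A, ssub_sren s, ssub_sren t, ssub_sren t', SSub.lift_compRen]
  | _, _, _, _, arrow _ A B, _, _ => by
    simp only [sren, ssub, ssub_sren A, ssub_sren B, SSub.lift_compRen, SSub.lock_compRen]
  | _, _, _, _, lam _ t, _, _ => by simp only [sren, ssub, ssub_sren t, SSub.lift_compRen]
  | _, _, _, _, app _ f t, _, _ => by
    simp only [sren, ssub, ssub_sren f, ssub_sren t, SSub.lock_compRen]
  | _, _, _, _, modTy _ A, _, _ => by simp only [sren, ssub, ssub_sren A, SSub.lock_compRen]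
  | _, _, _, _, modTm _ t, _, _ => by simp only [sren, ssub, ssub_sren t, SSub.lock_compRen]
  | _, _, _, _, letMod _ _ A B t s, _, _ => by
    simp only [sren, ssub, ssub_sren A, ssub_sren B, ssub_sren t, ssub_sren s, SSub.lift_compRen,
      SSub.lock_compRen]

theorem ssub_ofRen : {m : M} → {Γ Δ : SCtx m} → (t : SFExpr Δ) → (ρ : SRen Γ Δ) →
    t.ssub (SSub.ofRen ρ) = t.sren ρ
  | _, _, _, var _, _ => rfl
  | _, _, _, bool, _ => rfl
  | _, _, _, tt, _ => rfl
  | _, _, _, ff, _ => rfl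
  | _, _, _, ite A s t t', _ => by
    simp only [sren, ssub, SSub.lift_ofRen, ssub_ofRen A, ssub_ofRen s, ssub_ofRen t,
      ssub_ofRen t']
  | _, _, _, arrow _ A B, _ => by
    simp only [sren, ssub, SSub.lift_ofRen, SSub.lock_ofRen, ssub_ofRen A, ssub_ofRen B]
  | _, _, _, lam _ t, _ => by simp only [sren, ssub, SSub.lift_ofRen, ssub_ofRen t]
  | _, _, _, app _ f t, _ => by
    simp only [sren, ssub, SSub.lock_ofRen, ssub_ofRen f, ssub_ofRen t]
  | _, _, _, modTy _ A, _ => by simp only [sren, ssub, SSub.lock_ofRen, ssub_ofRen A]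
  | _, _, _, modTm _ t, _ => by simp only [sren, ssub, SSub.lock_ofRen, ssub_ofRen t]
  | _, _, _, letMod _ _ A B t s, _ => by
    simp only [sren, ssub, SSub.lift_ofRen, SSub.lock_ofRen, ssub_ofRen A, ssub_ofRen B,
      ssub_ofRen t, ssub_ofRen s]

end SFExpr

namespace SSub

theorem lock_comp {m n : M} {Γ Δ Ξ : SCtx n} (σ : SSub Δ Ξ) (τ : SSub Γ Δ) (μ : m ⟶ n) :
    (comp σ τ).lock μ = comp (σ.lock μ) (τ.lock μ) :=
  rfl

/-- On variables from `Ξ` this says that weakening commutes with `τ` below the locks `Λ`, which the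
two mixed fusion laws reduce to the same statement without locks. -/
theorem lift_comp {m n : M} {Γ Δ Ξ : SCtx n} (σ : SSub Δ Ξ) (τ : SSub Γ Δ) (μ : m ⟶ n) :
    (comp σ τ).lift μ = comp (σ.lift μ) (τ.lift μ) := by
  funext k Λ x
  cases x with
  | vzero α => exact (addLocks_flat (τ.lift μ) Λ (.vzero α)).symm
  | suc x =>
    change ((σ Λ x).ssub _).sren _ = ((σ Λ x).sren _).ssub _
    rw [SFExpr.ssub_sren, SFExpr.sren_ssub, ← addLocks_compRen, ← addLocks_renComp,
      weak_renComp_lift]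

end SSub

namespace SFExpr

theorem ssub_ssub : {m : M} → {Γ Δ Ξ : SCtx m} → (t : SFExpr Ξ) → (σ : SSub Δ Ξ) →
    (τ : SSub Γ Δ) → (t.ssub σ).ssub τ = t.ssub (σ.comp τ)
  | _, _, _, _, var _, _, _ => rfl
  | _, _, _, _, bool, _, _ => rfl
  | _, _, _, _, tt, _, _ => rfl
  | _, _, _, _, ff, _, _ => rfl
  | _, _, _, _, ite A s t t', _, _ => by
    simp only [ssub, ssub_ssub A, ssub_ssub s, ssub_ssub t, ssub_ssub t', SSub.lift_comp]
  | _, _, _, _, arrow _ A B, _, _ => by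
    simp only [ssub, ssub_ssub A, ssub_ssub B, SSub.lift_comp, SSub.lock_comp]
  | _, _, _, _, lam _ t, _, _ => by simp only [ssub, ssub_ssub t, SSub.lift_comp]
  | _, _, _, _, app _ f t, _, _ => by
    simp only [ssub, ssub_ssub f, ssub_ssub t, SSub.lock_comp]
  | _, _, _, _, modTy _ A, _, _ => by simp only [ssub, ssub_ssub A, SSub.lock_comp]
  | _, _, _, _, modTm _ t, _, _ => by simp only [ssub, ssub_ssub t, SSub.lock_comp]
  | _, _, _, _, letMod _ _ A B t s, _, _ => by
    simp only [ssub, ssub_ssub A, ssub_ssub B, ssub_ssub t, ssub_ssub s, SSub.lift_comp,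
      SSub.lock_comp]

end SFExpr

/-! ### Identities -/

namespace SRen

/-- The identity renaming. -/
def id {m : M} (Γ : SCtx m) : SRen Γ Γ := fun _ _ x => x

theorem lock_id {m n : M} (Γ : SCtx n) (μ : m ⟶ n) : (id Γ).lock μ = id (Γ.lock μ) := by
  funext k Λ x
  exact SFVar.lock_unlock x

theorem lift_id {m n : M} (Γ : SCtx n) (μ : m ⟶ n) : (id Γ).lift μ = id (Γ.ext μ) := by
  funext k Λ x
  cases x <;> rfl

theorem addLocks_id {m : M} : {n : M} → (Γ : SCtx n) → (Λ : LockTele m n) →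
    (id Γ).addLocks Λ = id (Γ.addLocks Λ)
  | _, _, .nil => rfl
  | _, Γ, .cons μ Λ => (congrArg (addLocks · Λ) (lock_id Γ μ)).trans (addLocks_id (Γ.lock μ) Λ)

/-- Renamings out of a locked context are determined by their values on joined variables. -/
theorem ext_join {m n : M} {Γ : SCtx n} {Δ : SCtx m} (Θ : LockTele n m)
    {ρ ρ' : SRen Γ (Δ.addLocks Θ)}
    (h : ∀ ⦃k : M⦄ (Λ : LockTele k n) (x : SFVar Δ (Θ.append Λ)),
      ρ Λ (.join Θ x) = ρ' Λ (.join Θ x)) : ρ = ρ' := by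
  funext k Λ x
  rw [← SFVar.join_split Θ x, h]

theorem ofEq_comp_ofEq_symm {m : M} {Γ Δ : SCtx m} (h : Γ = Δ) :
    (ofEq h).comp (ofEq h.symm) = id Δ := by
  subst h
  rfl

end SRen

theorem SFExpr.sren_id : {m : M} → {Γ : SCtx m} → (t : SFExpr Γ) → t.sren (SRen.id Γ) = t
  | _, _, var _ => rfl
  | _, _, bool => rfl
  | _, _, tt => rfl
  | _, _, ff => rfl
  | _, _, ite A s t t' => by
    simp only [sren, SRen.lift_id, sren_id A, sren_id s, sren_id t, sren_id t']
  | _, _, arrow _ A B => by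
    simp only [sren, SRen.lift_id, SRen.lock_id, sren_id A, sren_id B]
  | _, _, lam _ t => by simp only [sren, SRen.lift_id, sren_id t]
  | _, _, app _ f t => by simp only [sren, SRen.lock_id, sren_id f, sren_id t]
  | _, _, modTy _ A => by simp only [sren, SRen.lock_id, sren_id A]
  | _, _, modTm _ t => by simp only [sren, SRen.lock_id, sren_id t]
  | _, _, letMod _ _ A B t s => by
    simp only [sren, SRen.lift_id, SRen.lock_id, sren_id A, sren_id B, sren_id t, sren_id s]

namespace SSub

/-- The identity substitution. -/
def id {m : M} (Γ : SCtx m) : SSub Γ Γ := ofRen (.id Γ)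

theorem addLocks_ofRen {m : M} : {n : M} → {Γ Δ : SCtx n} → (ρ : SRen Γ Δ) →
    (Λ : LockTele m n) → (ofRen ρ).addLocks Λ = ofRen (ρ.addLocks Λ)
  | _, _, _, _, .nil => rfl
  | _, _, _, ρ, .cons μ Λ => addLocks_ofRen (ρ.lock μ) Λ

theorem addLocks_id {m n : M} (Γ : SCtx n) (Λ : LockTele m n) :
    (id Γ).addLocks Λ = id (Γ.addLocks Λ) := by
  rw [id, addLocks_ofRen, SRen.addLocks_id, id]

theorem lock_id {m n : M} (Γ : SCtx n) (μ : m ⟶ n) : (id Γ).lock μ = id (Γ.lock μ) :=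
  congrArg ofRen (SRen.lock_id Γ μ)

theorem lift_id {m n : M} (Γ : SCtx n) (μ : m ⟶ n) : (id Γ).lift μ = id (Γ.ext μ) := by
  rw [id, lift_ofRen, SRen.lift_id, id]

theorem id_compRen {m : M} {Γ Δ : SCtx m} (ρ : SRen Γ Δ) : compRen (id Δ) ρ = ofRen ρ := by
  funext k Λ x
  exact congrArg SFExpr.var (SRen.addLocks_flat ρ Λ x)

/-- The analogue of `SRen.addLocks_join`. The two sides are expressions in the contexts
`(Γ.Θ).Λ` and `Γ.(Θ.Λ)`, which are not definitionally equal. -/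
theorem addLocks_join {k m : M} {Λ : LockTele k m} : {n : M} → {Γ Δ : SCtx n} → (σ : SSub Γ Δ) →
    (Θ : LockTele m n) → (x : SFVar Δ (Θ.append Λ)) →
    σ.addLocks Θ Λ (.join Θ x) =
      (σ (Θ.append Λ) x).sren (SRen.ofEq (Γ.addLocks_append Θ Λ).symm)
  | _, _, _, _, .nil, _ => (SFExpr.sren_id _).symm
  | _, _, _, σ, .cons μ Θ, x => addLocks_join (σ.lock μ) Θ (.lock x)

end SSub

theorem SFExpr.ssub_id {m : M} {Γ : SCtx m} (t : SFExpr Γ) : t.ssub (SSub.id Γ) = t :=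
  (t.ssub_ofRen _).trans t.sren_id

variable [Bicategory.Strict M]

/-! ### Horizontal composition of 2-cells between lock telescopes -/

namespace LockTele

open Bicategory

theorem hcomp_id {k m n : M} (Λ : LockTele m n) (Θ : LockTele k m) :
    hcomp (𝟙 Λ.locks) (𝟙 Θ.locks) = 𝟙 (Λ.append Θ).locks := by
  simp [hcomp]

theorem hcomp_comp {k m n : M} {Λ₁ Λ₂ Λ₃ : LockTele m n} {Θ₁ Θ₂ Θ₃ : LockTele k m}
    (β : Λ₁.locks ⟶ Λ₂.locks) (β' : Λ₂.locks ⟶ Λ₃.locks) (α : Θ₁.locks ⟶ Θ₂.locks)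
    (α' : Θ₂.locks ⟶ Θ₃.locks) :
    hcomp β α ≫ hcomp β' α' = hcomp (β ≫ β') (α ≫ α') := by
  simp [hcomp, whisker_exchange_assoc]

/-- `LockTele.hcomp` for arbitrary 1-cells `p₁`, `p₂` that are equal to the composites. The
coherence laws of horizontal composition are proved for this version, where the equations between
1-cells can be eliminated by substitution. -/
def hcompOfEq {a b c : M} {f₁ f₂ : b ⟶ c} {g₁ g₂ : a ⟶ b} {p₁ p₂ : a ⟶ c} (h₁ : p₁ = g₁ ≫ f₁)
    (h₂ : p₂ = g₂ ≫ f₂) (β : f₁ ⟶ f₂) (α : g₁ ⟶ g₂) : p₁ ⟶ p₂ :=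
  eqToHom h₁ ≫ (α ▷ f₁ ≫ g₂ ◁ β) ≫ eqToHom h₂.symm

theorem hcompOfEq_whiskerRight {a b c d : M} {f₁ f₂ : b ⟶ c} {g₁ g₂ : a ⟶ b} {p₁ p₂ : a ⟶ c}
    (h₁ : p₁ = g₁ ≫ f₁) (h₂ : p₂ = g₂ ≫ f₂) (μ : c ⟶ d) (h₁' : p₁ ≫ μ = g₁ ≫ f₁ ≫ μ)
    (h₂' : p₂ ≫ μ = g₂ ≫ f₂ ≫ μ) (β : f₁ ⟶ f₂) (α : g₁ ⟶ g₂) :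
    hcompOfEq h₁' h₂' (β ▷ μ) α = hcompOfEq h₁ h₂ β α ▷ μ := by
  subst h₁ h₂
  simp [hcompOfEq, Strict.associator_eqToIso]

theorem hcompOfEq_hcompOfEq {a b c d : M} {f₁ f₂ : c ⟶ d} {g₁ g₂ : b ⟶ c} {h₁ h₂ : a ⟶ b}
    {p₁ p₂ : b ⟶ d} {q₁ q₂ r₁ r₂ : a ⟶ d} {s₁ s₂ : a ⟶ c} (hp₁ : p₁ = g₁ ≫ f₁)
    (hp₂ : p₂ = g₂ ≫ f₂) (hq₁ : q₁ = h₁ ≫ p₁) (hq₂ : q₂ = h₂ ≫ p₂) (hs₁ : s₁ = h₁ ≫ g₁)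
    (hs₂ : s₂ = h₂ ≫ g₂) (hr₁ : r₁ = s₁ ≫ f₁) (hr₂ : r₂ = s₂ ≫ f₂) (e₁ : q₁ = r₁) (e₂ : q₂ = r₂)
    (γ : f₁ ⟶ f₂) (β : g₁ ⟶ g₂) (α : h₁ ⟶ h₂) :
    hcompOfEq hq₁ hq₂ (hcompOfEq hp₁ hp₂ γ β) α ≫ eqToHom e₂ =
      eqToHom e₁ ≫ hcompOfEq hr₁ hr₂ γ (hcompOfEq hs₁ hs₂ β α) := by
  subst hp₁ hp₂ hq₁ hq₂ hs₁ hs₂ hr₁ hr₂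
  simp [hcompOfEq, Strict.associator_eqToIso]

theorem hcomp_whiskerRight {k m n o : M} {Λ₁ Λ₂ : LockTele m n} {Θ₁ Θ₂ : LockTele k m} (μ : n ⟶ o)
    (β : Λ₁.locks ⟶ Λ₂.locks) (α : Θ₁.locks ⟶ Θ₂.locks) :
    hcomp (Λ₁ := .cons μ Λ₁) (Λ₂ := .cons μ Λ₂) (β ▷ μ) α = hcomp β α ▷ μ :=
  hcompOfEq_whiskerRight (locks_append Λ₁ Θ₁) (locks_append Λ₂ Θ₂) μ
    (locks_append (.cons μ Λ₁) Θ₁) (locks_append (.cons μ Λ₂) Θ₂) β α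

theorem hcompOfEq_id_left {a b : M} {g₁ g₂ p₁ p₂ : a ⟶ b} (h₁ : p₁ = g₁ ≫ 𝟙 b)
    (h₂ : p₂ = g₂ ≫ 𝟙 b) (e₁ : p₁ = g₁) (e₂ : g₂ = p₂) (α : g₁ ⟶ g₂) :
    hcompOfEq h₁ h₂ (𝟙 (𝟙 b)) α = eqToHom e₁ ≫ α ≫ eqToHom e₂ := by
  subst h₁ h₂
  simp [hcompOfEq, Strict.rightUnitor_eqToIso]

theorem hcompOfEq_id_right {a b : M} {f₁ f₂ p₁ p₂ : a ⟶ b} (h₁ : p₁ = 𝟙 a ≫ f₁)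
    (h₂ : p₂ = 𝟙 a ≫ f₂) (e₁ : p₁ = f₁) (e₂ : f₂ = p₂) (β : f₁ ⟶ f₂) :
    hcompOfEq h₁ h₂ β (𝟙 (𝟙 a)) = eqToHom e₁ ≫ β ≫ eqToHom e₂ := by
  subst h₁ h₂
  simp [hcompOfEq, Strict.leftUnitor_eqToIso]

theorem nil_hcomp {k m : M} {Θ₁ Θ₂ : LockTele k m} (α : Θ₁.locks ⟶ Θ₂.locks) :
    hcomp (𝟙 (nil : LockTele m m).locks) α = α :=
  (hcompOfEq_id_left (locks_append nil Θ₁) (locks_append nil Θ₂) rfl rfl α).trans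
    ((Category.id_comp _).trans (Category.comp_id α))

theorem append_nil_locks {m n : M} (Λ : LockTele m n) : (Λ.append nil).locks = Λ.locks :=
  (locks_append Λ nil).trans (Strict.id_comp _)

theorem hcomp_nil {m n : M} {Λ₁ Λ₂ : LockTele m n} (β : Λ₁.locks ⟶ Λ₂.locks) :
    hcomp β (𝟙 (nil : LockTele m m).locks) =
      eqToHom (append_nil_locks Λ₁) ≫ β ≫ eqToHom (append_nil_locks Λ₂).symm :=
  hcompOfEq_id_right (locks_append Λ₁ nil) (locks_append Λ₂ nil) _ _ β

theorem append_append_locks {j k m n : M} (Λ : LockTele m n) (Θ : LockTele k m)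
    (Ψ : LockTele j k) :
    ((Λ.append Θ).append Ψ).locks = (Λ.append (Θ.append Ψ)).locks := by
  simp [locks_append]

theorem hcomp_hcomp {j k m n : M} {Λ₁ Λ₂ : LockTele m n} {Θ₁ Θ₂ : LockTele k m}
    {Ψ₁ Ψ₂ : LockTele j k} (γ : Λ₁.locks ⟶ Λ₂.locks) (β : Θ₁.locks ⟶ Θ₂.locks)
    (α : Ψ₁.locks ⟶ Ψ₂.locks) :
    hcomp (hcomp γ β) α ≫ eqToHom (append_append_locks Λ₂ Θ₂ Ψ₂) =
      eqToHom (append_append_locks Λ₁ Θ₁ Ψ₁) ≫ hcomp γ (hcomp β α) :=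
  hcompOfEq_hcompOfEq (locks_append _ _) (locks_append _ _) (locks_append _ _) (locks_append _ _)
    (locks_append _ _) (locks_append _ _) (locks_append _ _) (locks_append _ _) _ _ γ β α

end LockTele

namespace SFVar

open scoped Bicategory

theorem transf_join {k m : M} {Λ Λ' : LockTele k m} (α : Λ.locks ⟶ Λ'.locks) : {n : M} →
    {Γ : SCtx n} → (Θ : LockTele m n) → (x : SFVar Γ (Θ.append Λ)) →
    transf α (join Θ x) = join Θ (transf (LockTele.hcomp (𝟙 Θ.locks) α) x)
  | _, _, .nil, x => congrArg (transf · x) (LockTele.nil_hcomp α).symm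
  | _, _, .cons μ Θ, x => by
    have h : LockTele.hcomp (𝟙 Θ.locks) α ▷ μ =
        LockTele.hcomp (𝟙 (LockTele.cons μ Θ).locks) α := by
      rw [← LockTele.hcomp_whiskerRight, Bicategory.id_whiskerRight]
      rfl
    exact (transf_join α Θ (lock x)).trans
      (congrArg (fun a => join Θ (lock (transf (Θ := .cons μ (Θ.append Λ))
        (Ψ := .cons μ (Θ.append Λ')) a x))) h)

/-- Flattening is joining with the empty telescope on the right. -/
theorem flat_eq_join {m : M} : {n : M} → {Γ : SCtx n} → (Θ : LockTele m n) → (x : SFVar Γ Θ) →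
    flat Θ x = join Θ (transf (eqToHom Θ.append_nil_locks.symm) x)
  | _, _, .nil, x => (transf_id x).symm
  | _, _, .cons μ Θ, x => by
    refine (flat_eq_join Θ (lock x)).trans ?_
    rw [transf_lock, Bicategory.eqToHom_whiskerRight]
    rfl

end SFVar

/-! ### Keys -/

namespace SRen

/-- The renaming given by the key of a 2-cell. -/
def key {m n : M} (Γ : SCtx m) (Θ Ψ : LockTele n m) (β : Θ.locks ⟶ Ψ.locks) :
    SRen (Γ.addLocks Ψ) (Γ.addLocks Θ) :=
  fun _ Λ x => .join Ψ (.transf (LockTele.hcomp β (𝟙 Λ.locks)) (.split Θ x))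

theorem key_join {k m n : M} {Γ : SCtx m} {Θ Ψ : LockTele n m} (β : Θ.locks ⟶ Ψ.locks)
    {Λ : LockTele k n} (x : SFVar Γ (Θ.append Λ)) :
    key Γ Θ Ψ β Λ (.join Θ x) = .join Ψ (.transf (LockTele.hcomp β (𝟙 Λ.locks)) x) := by
  rw [key, SFVar.split_join]

theorem key_id {m n : M} (Γ : SCtx m) (Θ : LockTele n m) :
    key Γ Θ Θ (𝟙 Θ.locks) = id (Γ.addLocks Θ) := by
  refine ext_join Θ fun k Λ x => ?_
  rw [key_join, LockTele.hcomp_id, SFVar.transf_id, id]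

theorem key_comp {m n : M} (Γ : SCtx m) {Θ Ψ Φ : LockTele n m} (α : Θ.locks ⟶ Ψ.locks)
    (β : Ψ.locks ⟶ Φ.locks) : (key Γ Θ Ψ α).comp (key Γ Ψ Φ β) = key Γ Θ Φ (α ≫ β) := by
  refine ext_join Θ fun k Λ x => ?_
  rw [comp, key_join, key_join, key_join, SFVar.transf_transf, LockTele.hcomp_comp,
    Category.comp_id]

theorem key_flat {m n : M} {Γ : SCtx m} {Θ Ψ : LockTele n m} (α : Θ.locks ⟶ Ψ.locks)
    (x : SFVar Γ Θ) : key Γ Θ Ψ α .nil (.flat Θ x) = .flat Ψ (.transf α x) := by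
  rw [SFVar.flat_eq_join, SFVar.flat_eq_join, key_join, SFVar.transf_transf, SFVar.transf_transf,
    LockTele.hcomp_nil, eqToHom_trans_assoc, eqToHom_refl, Category.id_comp]

open scoped Bicategory in
theorem key_lock {m n o : M} (Γ : SCtx o) (μ : m ⟶ o) {Θ Ψ : LockTele n m}
    (α : Θ.locks ⟶ Ψ.locks) :
    key (Γ.lock μ) Θ Ψ α = key Γ (.cons μ Θ) (.cons μ Ψ) (α ▷ μ) := by
  refine ext_join Θ fun k Λ x => ?_
  cases x with
  | lock x =>
    refine (key_join α _).trans (Eq.trans ?_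
      (key_join (Θ := .cons μ Θ) (Ψ := .cons μ Ψ) (α ▷ μ) x).symm)
    rw [LockTele.hcomp_whiskerRight]
    rfl

/-- Regrouping the locks `Θ.Λ` of a context, on variables. -/
theorem ofEq_join {k m : M} {Λ : LockTele k m} {j : M} {Φ : LockTele j k} : {n : M} →
    {Γ : SCtx n} → (Θ : LockTele m n) → (x : SFVar Γ ((Θ.append Λ).append Φ)) →
    ofEq (Γ.addLocks_append Θ Λ).symm Φ (.join (Θ.append Λ) x) =
      .join Λ (.join Θ (.transf (eqToHom (Θ.append_append_locks Λ Φ)) x))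
  | _, Γ, .nil, x => congrArg (SFVar.join Λ) (SFVar.transf_id x).symm
  | _, Γ, .cons μ Θ, x => by
    exact (ofEq_join Θ (.lock x)).trans
      (congrArg (fun a => SFVar.join Λ (.join Θ (.lock (.transf
        (Θ := .cons μ ((Θ.append Λ).append Φ)) (Ψ := .cons μ (Θ.append (Λ.append Φ))) a x))))
        (Bicategory.eqToHom_whiskerRight (Θ.append_append_locks Λ Φ) μ))

/-- The key of a horizontal composite is a composite of keys, up to regrouping locks. -/
theorem key_hcomp {m n o : M} (Γ : SCtx m) {Θ₁ Θ₂ : LockTele o n} {Λ₁ Λ₂ : LockTele n m}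
    (α : Θ₁.locks ⟶ Θ₂.locks) (β : Λ₁.locks ⟶ Λ₂.locks) :
    (key Γ (Λ₁.append Θ₁) (Λ₂.append Θ₂) (LockTele.hcomp β α)).comp
        (ofEq (Γ.addLocks_append Λ₂ Θ₂).symm) =
      (ofEq (Γ.addLocks_append Λ₁ Θ₁).symm).comp
        (((key Γ Λ₁ Λ₂ β).addLocks Θ₁).comp (key (Γ.addLocks Λ₂) Θ₁ Θ₂ α)) := by
  refine ext_join (Λ₁.append Θ₁) fun k Φ x => ?_
  rw [comp, comp, comp, key_join, ofEq_join, ofEq_join, addLocks_join, key_join, key_join,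
    SFVar.transf_join, SFVar.transf_transf, SFVar.transf_transf, SFVar.transf_transf,
    LockTele.hcomp_hcomp, LockTele.hcomp_comp, Category.comp_id, Category.id_comp]

/-- A key under further locks is the key of a whiskered 2-cell, up to regrouping locks. -/
theorem key_append {m n o : M} (Γ : SCtx m) {Λ₁ Λ₂ : LockTele n m} (β : Λ₁.locks ⟶ Λ₂.locks)
    (Θ : LockTele o n) :
    (key Γ (Λ₁.append Θ) (Λ₂.append Θ) (LockTele.hcomp β (𝟙 Θ.locks))).comp
        (ofEq (Γ.addLocks_append Λ₂ Θ).symm) =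
      (ofEq (Γ.addLocks_append Λ₁ Θ).symm).comp ((key Γ Λ₁ Λ₂ β).addLocks Θ) := by
  rw [key_hcomp, key_id]
  rfl

end SRen

/-! ### Naturality -/

/-- A renaming is natural if it commutes with the action of 2-cells on variables. -/
def SRen.IsNatural {m : M} {Γ Δ : SCtx m} (ρ : SRen Γ Δ) : Prop :=
  ∀ ⦃k : M⦄ ⦃Θ Ψ : LockTele k m⦄ (α : Θ.locks ⟶ Ψ.locks) (x : SFVar Δ Θ),
    ρ Ψ (.transf α x) = .transf α (ρ Θ x)

/-- A substitution is natural if it turns the action of 2-cells on variables into the action of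
keys on expressions. -/
def SSub.IsNatural {m : M} {Γ Δ : SCtx m} (σ : SSub Γ Δ) : Prop :=
  ∀ ⦃k : M⦄ ⦃Θ Ψ : LockTele k m⦄ (α : Θ.locks ⟶ Ψ.locks) (x : SFVar Δ Θ),
    σ Ψ (.transf α x) = (σ Θ x).sren (.key Γ Θ Ψ α)

namespace SRen

theorem IsNatural.key_comp_addLocks {m n : M} {Γ Δ : SCtx m} {ρ : SRen Γ Δ} (hρ : ρ.IsNatural)
    {Θ Ψ : LockTele n m} (α : Θ.locks ⟶ Ψ.locks) :
    (key Δ Θ Ψ α).comp (ρ.addLocks Ψ) = (ρ.addLocks Θ).comp (key Γ Θ Ψ α) := by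
  refine ext_join Θ fun k Λ x => ?_
  rw [comp, comp, key_join, addLocks_join, addLocks_join, key_join, hρ]

theorem isNatural_key {m n : M} (Γ : SCtx m) {Θ Ψ : LockTele n m} (β : Θ.locks ⟶ Ψ.locks) :
    (key Γ Θ Ψ β).IsNatural := by
  intro k Λ Λ' α x
  obtain ⟨y, rfl⟩ : ∃ y, x = .join Θ y := ⟨_, (SFVar.join_split Θ x).symm⟩
  rw [SFVar.transf_join, key_join, key_join, SFVar.transf_join, SFVar.transf_transf,
    SFVar.transf_transf, LockTele.hcomp_comp, LockTele.hcomp_comp]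
  simp only [Category.id_comp, Category.comp_id]

end SRen

namespace SSub

/-- Extension of a substitution with a term for the last variable. -/
def extend {m n : M} {Γ Δ : SCtx n} {μ : m ⟶ n} (σ : SSub Γ Δ) (t : SFExpr (Γ.lock μ)) :
    SSub Γ (Δ.ext μ)
  | _, Λ, .vzero α => t.sren (.key Γ (.single μ) Λ (LockTele.fromSingle α))
  | _, Λ, .suc x => σ Λ x

/-- Natural substitutions commute with keys. -/
theorem IsNatural.key_renComp_addLocks {m n : M} {Γ Δ : SCtx m} {σ : SSub Γ Δ}
    (hσ : σ.IsNatural) {Θ Ψ : LockTele n m} (α : Θ.locks ⟶ Ψ.locks) :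
    renComp (.key Δ Θ Ψ α) (σ.addLocks Ψ) = compRen (σ.addLocks Θ) (.key Γ Θ Ψ α) := by
  funext k Λ x
  obtain ⟨y, rfl⟩ : ∃ y, x = .join Θ y := ⟨_, (SFVar.join_split Θ x).symm⟩
  rw [renComp, compRen, SRen.key_join, addLocks_join, addLocks_join, hσ, SFExpr.sren_sren,
    SFExpr.sren_sren, SRen.key_append]

theorem IsNatural.ssub_key {m n : M} {Γ Δ : SCtx m} {σ : SSub Γ Δ} (hσ : σ.IsNatural)
    {Θ Ψ : LockTele n m} (α : Θ.locks ⟶ Ψ.locks) (t : SFExpr (Δ.addLocks Θ)) :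
    (t.sren (.key Δ Θ Ψ α)).ssub (σ.addLocks Ψ) = (t.ssub (σ.addLocks Θ)).sren (.key Γ Θ Ψ α) := by
  rw [SFExpr.sren_ssub, SFExpr.ssub_sren, hσ.key_renComp_addLocks]

theorem isNatural_ofRen {m : M} {Γ Δ : SCtx m} {ρ : SRen Γ Δ} (hρ : ρ.IsNatural) :
    (ofRen ρ).IsNatural := by
  intro k Θ Ψ α x
  rw [ofRen, ofRen, hρ]
  exact congrArg SFExpr.var (SRen.key_flat α _).symm

theorem isNatural_id {m : M} (Γ : SCtx m) : (id Γ).IsNatural :=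
  isNatural_ofRen fun _ _ _ _ _ => rfl

theorem IsNatural.compRen {m : M} {Γ Δ Ξ : SCtx m} {σ : SSub Δ Ξ} (hσ : σ.IsNatural)
    {ρ : SRen Γ Δ} (hρ : ρ.IsNatural) : (compRen σ ρ).IsNatural := by
  intro k Θ Ψ α x
  rw [SSub.compRen, SSub.compRen, hσ, SFExpr.sren_sren, SFExpr.sren_sren,
    hρ.key_comp_addLocks]

theorem IsNatural.lock {m n : M} {Γ Δ : SCtx n} {σ : SSub Γ Δ} (hσ : σ.IsNatural) (μ : m ⟶ n) :
    (σ.lock μ).IsNatural := by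
  intro k Θ Ψ α x
  cases x with
  | lock x =>
    rw [SRen.key_lock]
    exact hσ (Θ := .cons μ Θ) (Ψ := .cons μ Ψ) _ x

/-- On the last variable, naturality is functoriality of keys for vertical composition. -/
theorem IsNatural.extend {m n : M} {Γ Δ : SCtx n} {μ : m ⟶ n} {σ : SSub Γ Δ} (hσ : σ.IsNatural)
    (t : SFExpr (Γ.lock μ)) : (σ.extend t).IsNatural := by
  intro k Θ Ψ α x
  cases x with
  | vzero β =>
    have h : LockTele.fromSingle (β ≫ α) = LockTele.fromSingle β ≫ α :=
      (Category.assoc _ _ _).symm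
    exact (congrArg (SFExpr.sren (Δ := Γ.addLocks (.single μ)) t)
      ((congrArg (SRen.key Γ (.single μ) Ψ) h).trans (SRen.key_comp Γ _ α).symm)).trans
      (SFExpr.sren_sren (Ξ := Γ.addLocks (.single μ)) t _ _).symm
  | suc x => exact hσ α x

theorem weak_renComp_extend {m n : M} {Γ Δ : SCtx n} {μ : m ⟶ n} (σ : SSub Γ Δ)
    (t : SFExpr (Γ.lock μ)) : renComp .weak (σ.extend t) = σ :=
  rfl

/-- Instantiating the last variable commutes with natural substitutions. -/
theorem IsNatural.lift_comp_extend {m n : M} {Γ Δ : SCtx n} {μ : m ⟶ n} {τ : SSub Γ Δ}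
    (hτ : τ.IsNatural) (s : SFExpr (Δ.lock μ)) :
    (τ.lift μ).comp ((id Γ).extend (s.ssub (τ.lock μ))) = ((id Δ).extend s).comp τ := by
  funext k Λ x
  cases x with
  | vzero α =>
    refine (addLocks_flat _ Λ (.vzero α)).trans ?_
    exact (hτ.ssub_key (Θ := .single μ) (LockTele.fromSingle α) s).symm
  | suc x =>
    change ((τ Λ x).sren _).ssub _ = (SFExpr.var (.flat Λ x)).ssub _
    rw [SFExpr.sren_ssub, ← addLocks_renComp, weak_renComp_extend, addLocks_id, SFExpr.ssub_id]
    exact (addLocks_flat τ Λ x).symm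

end SSub

/-- The last variable of `(Γ, μ).🔒μ`, moved along a key. -/
theorem SFVar.key_zeroOne {m n : M} {Γ : SCtx n} {μ : m ⟶ n}
    (Λ : LockTele m n) (α : μ ⟶ Λ.locks) :
    SRen.key (Γ.ext μ) (.single μ) Λ (LockTele.fromSingle α) .nil (zeroOne Γ μ) =
      flat Λ (vzero α) := by
  refine (SRen.key_flat _ (vzero (Λ := .single μ) _)).trans ?_
  simp [transf, LockTele.fromSingle]

/-- The lift of a substitution is its extension with the last variable. -/
theorem SSub.lift_eq_extend {m n : M} {Γ Δ : SCtx n} (σ : SSub Γ Δ) (μ : m ⟶ n) :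
    σ.lift μ = (compRen σ .weak).extend (.var (.zeroOne Γ μ)) := by
  funext k Λ x
  cases x with
  | vzero α => exact congrArg SFExpr.var (SFVar.key_zeroOne Λ α).symm
  | suc x => rfl

/-- Weakening under the last variable, followed by instantiation with the last variable. -/
theorem SSub.weak_lift_renComp_extend {m n : M} (Γ : SCtx n) (μ : m ⟶ n) :
    renComp (SRen.weak.lift μ) ((id (Γ.ext μ)).extend (.var (.zeroOne Γ μ))) = id (Γ.ext μ) := by
  funext k Λ x
  cases x with
  | vzero α => exact congrArg SFExpr.var (SFVar.key_zeroOne Λ α)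
  | suc x => rfl

/-! ### Atomic renamings and substitutions as functions -/

/-- The functional renaming given by an atomic renaming. -/
def SRen.ofARen {m : M} {Γ Δ : SCtx m} (ρ : ARen Γ Δ) : SRen Γ Δ := fun _ Λ x => x.ren ρ Λ

/-- The functional substitution given by an atomic substitution. -/
def SSub.ofASub {m : M} {Γ Δ : SCtx m} (σ : ASub Γ Δ) : SSub Γ Δ := fun _ Λ x => x.sub σ Λ

namespace SRen

theorem ofARen_lock {m n : M} {Γ Δ : SCtx n} (ρ : ARen Γ Δ) (μ : m ⟶ n) :
    ofARen (ρ.lock μ) = (ofARen ρ).lock μ := by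
  funext k Λ x
  cases x
  rfl

theorem ofARen_addLocks {m : M} : {n : M} → {Γ Δ : SCtx n} → (ρ : ARen Γ Δ) →
    (Λ : LockTele m n) → ofARen (ρ.addLocks Λ) = (ofARen ρ).addLocks Λ
  | _, _, _, _, .nil => rfl
  | _, _, _, ρ, .cons μ Λ =>
    (ofARen_addLocks (ρ.lock μ) Λ).trans (congrArg (SRen.addLocks · Λ) (ofARen_lock ρ μ))

theorem ofARen_lift {m n : M} {Γ Δ : SCtx n} (ρ : ARen Γ Δ) (μ : m ⟶ n) :
    ofARen (ρ.lift (fun _ _ Γ μ => .zeroOne Γ μ) μ) = (ofARen ρ).lift μ := by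
  funext k Λ x
  cases x with
  | vzero α =>
    change SFVar.vzero (_ ≫ LockTele.fromSingle α) = SFVar.vzero α
    simp [LockTele.fromSingle]
  | suc x => rfl

theorem ofARen_pi {m n : M} {Γ : SCtx n} {μ : m ⟶ n} :
    ofARen (.pi : ARen (Γ.ext μ) Γ) = weak :=
  rfl

end SRen

theorem SFExpr.ren_eq_sren : {m : M} → {Γ Δ : SCtx m} → (t : SFExpr Δ) → (ρ : ARen Γ Δ) →
    t.ren ρ = t.sren (SRen.ofARen ρ)
  | _, _, _, var _, _ => rfl
  | _, _, _, bool, _ => rfl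
  | _, _, _, tt, _ => rfl
  | _, _, _, ff, _ => rfl
  | _, _, _, ite A s t t', _ => by
    simp only [sren, ← SRen.ofARen_lift, ← ren_eq_sren A, ← ren_eq_sren s, ← ren_eq_sren t,
      ← ren_eq_sren t']
    rfl
  | _, _, _, arrow _ A B, _ => by
    simp only [sren, ← SRen.ofARen_lift, ← SRen.ofARen_lock, ← ren_eq_sren A, ← ren_eq_sren B]
    rfl
  | _, _, _, lam _ t, _ => by
    simp only [sren, ← SRen.ofARen_lift, ← ren_eq_sren t]
    rfl
  | _, _, _, app _ f t, _ => by
    simp only [sren, ← SRen.ofARen_lock, ← ren_eq_sren f, ← ren_eq_sren t]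
    rfl
  | _, _, _, modTy _ A, _ => by
    simp only [sren, ← SRen.ofARen_lock, ← ren_eq_sren A]
    rfl
  | _, _, _, modTm _ t, _ => by
    simp only [sren, ← SRen.ofARen_lock, ← ren_eq_sren t]
    rfl
  | _, _, _, letMod _ _ A B t s, _ => by
    simp only [sren, ← SRen.ofARen_lift, ← SRen.ofARen_lock, ← ren_eq_sren A, ← ren_eq_sren B,
      ← ren_eq_sren t, ← ren_eq_sren s]
    rfl

namespace SSub

theorem ofASub_id {m : M} (Γ : SCtx m) : ofASub (.id : ASub Γ Γ) = id Γ :=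
  rfl

theorem ofASub_weaken {m n : M} {Γ Δ : SCtx n} {μ : m ⟶ n} (σ : ASub Γ Δ) :
    ofASub (.weaken σ : ASub (Γ.ext μ) Δ) = compRen (ofASub σ) .weak := by
  funext k Λ x
  refine (SFExpr.ren_eq_sren _ _).trans ?_
  rw [SRen.ofARen_addLocks, SRen.ofARen_pi]
  rfl

theorem ofASub_lock {m n : M} {Γ Δ : SCtx n} (σ : ASub Γ Δ) (μ : m ⟶ n) :
    ofASub (σ.lock μ) = (ofASub σ).lock μ := by
  funext k Λ x
  cases x
  rfl

theorem ofASub_key {m n : M} (Γ : SCtx m) (Θ Ψ : LockTele n m) (β : Θ.locks ⟶ Ψ.locks) :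
    ofASub (.key Γ Θ Ψ β) = ofRen (.key Γ Θ Ψ β) :=
  rfl

theorem ofASub_extend {m n : M} {Γ Δ : SCtx n} {μ : m ⟶ n} (σ : ASub Γ Δ)
    (t : SFExpr (Γ.lock μ)) : ofASub (.extend σ t) = (ofASub σ).extend t := by
  funext k Λ x
  cases x with
  | vzero α => exact SFExpr.ren_eq_sren _ _
  | suc x => rfl

theorem ofASub_lift {m n : M} {Γ Δ : SCtx n} (σ : ASub Γ Δ) (μ : m ⟶ n) :
    ofASub (σ.lift (fun _ _ Γ μ => .var (.zeroOne Γ μ)) μ) = (ofASub σ).lift μ := by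
  rw [lift_eq_extend, ← ofASub_weaken, ← ofASub_extend]
  rfl

theorem isNatural_ofASub : {m : M} → {Γ Δ : SCtx m} → (σ : ASub Γ Δ) → (ofASub σ).IsNatural
  | _, _, _, .bang => fun _ _ _ _ x => nomatch x
  | _, _, _, .id => isNatural_id _
  | _, _, _, .weaken σ =>
    ofASub_weaken σ ▸ (isNatural_ofASub σ).compRen fun _ _ _ _ _ => rfl
  | _, _, _, .lock σ μ => ofASub_lock σ μ ▸ (isNatural_ofASub σ).lock μ
  | _, _, _, .key Γ _ _ β => isNatural_ofRen (SRen.isNatural_key Γ β)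
  | _, _, _, .extend σ t => ofASub_extend σ t ▸ (isNatural_ofASub σ).extend t

end SSub

theorem SFExpr.asub_eq_ssub : {m : M} → {Γ Δ : SCtx m} → (t : SFExpr Δ) → (σ : ASub Γ Δ) →
    t.asub σ = t.ssub (SSub.ofASub σ)
  | _, _, _, var _, _ => rfl
  | _, _, _, bool, _ => rfl
  | _, _, _, tt, _ => rfl
  | _, _, _, ff, _ => rfl
  | _, _, _, ite A s t t', _ => by
    simp only [ssub, ← SSub.ofASub_lift, ← asub_eq_ssub A, ← asub_eq_ssub s, ← asub_eq_ssub t,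
      ← asub_eq_ssub t']
    rfl
  | _, _, _, arrow _ A B, _ => by
    simp only [ssub, ← SSub.ofASub_lift, ← SSub.ofASub_lock, ← asub_eq_ssub A, ← asub_eq_ssub B]
    rfl
  | _, _, _, lam _ t, _ => by
    simp only [ssub, ← SSub.ofASub_lift, ← asub_eq_ssub t]
    rfl
  | _, _, _, app _ f t, _ => by
    simp only [ssub, ← SSub.ofASub_lock, ← asub_eq_ssub f, ← asub_eq_ssub t]
    rfl
  | _, _, _, modTy _ A, _ => by
    simp only [ssub, ← SSub.ofASub_lock, ← asub_eq_ssub A]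
    rfl
  | _, _, _, modTm _ t, _ => by
    simp only [ssub, ← SSub.ofASub_lock, ← asub_eq_ssub t]
    rfl
  | _, _, _, letMod _ _ A B t s, _ => by
    simp only [ssub, ← SSub.ofASub_lift, ← SSub.ofASub_lock, ← asub_eq_ssub A, ← asub_eq_ssub B,
      ← asub_eq_ssub t, ← asub_eq_ssub s]
    rfl

/-! ### Sequences of atomic substitutions as functions -/

/-- The functional substitution given by a sequence of atomic substitutions. -/
def SSub.ofSFSub : {m : M} → {Γ Δ : SCtx m} → SFSub Γ Δ → SSub Γ Δ
  | _, _, _, .id => id _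
  | _, _, _, .snoc σ τ => (ofSFSub σ).comp (ofASub τ)

theorem SFExpr.sub_eq_ssub : {m : M} → {Γ Δ : SCtx m} → (t : SFExpr Δ) → (σ : SFSub Γ Δ) →
    t.sub σ = t.ssub (SSub.ofSFSub σ)
  | _, _, _, t, .id => by rw [sub, SSub.ofSFSub, ssub_id]
  | _, _, _, t, .snoc σ τ => by
    rw [sub, sub_eq_ssub t σ, asub_eq_ssub, ssub_ssub, SSub.ofSFSub]

namespace SSub

theorem ofSFSub_lock {m n : M} : {Γ Δ : SCtx n} → (σ : SFSub Γ Δ) → (μ : m ⟶ n) →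
    ofSFSub (σ.lock μ) = (ofSFSub σ).lock μ
  | _, _, .id, μ => by rw [SFSub.lock, ofSFSub, ofSFSub, lock_id]
  | _, _, .snoc σ τ, μ => by
    rw [SFSub.lock, ofSFSub, ofSFSub, ofSFSub_lock σ, ofASub_lock, lock_comp]

theorem ofSFSub_lift {m n : M} : {Γ Δ : SCtx n} → (σ : SFSub Γ Δ) → (μ : m ⟶ n) →
    ofSFSub (σ.lift μ) = (ofSFSub σ).lift μ
  | _, _, .id, μ => by rw [SFSub.lift, ofSFSub, ofSFSub, lift_id]
  | _, _, .snoc σ τ, μ => by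
    rw [SFSub.lift, ofSFSub, ofSFSub, ofSFSub_lift σ, ofASub_lift, lift_comp]

theorem IsNatural.comp {m : M} {Γ Δ Ξ : SCtx m} {σ : SSub Δ Ξ} {τ : SSub Γ Δ} (hσ : σ.IsNatural)
    (hτ : τ.IsNatural) : (comp σ τ).IsNatural := by
  intro k Θ Ψ α x
  rw [SSub.comp, SSub.comp, hσ, hτ.ssub_key]

theorem isNatural_ofSFSub : {m : M} → {Γ Δ : SCtx m} → (σ : SFSub Γ Δ) → (ofSFSub σ).IsNatural
  | _, _, _, .id => by
    rw [ofSFSub]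
    exact isNatural_id _
  | _, _, _, .snoc σ τ => by
    rw [ofSFSub]
    exact (isNatural_ofSFSub σ).comp (isNatural_ofASub τ)

end SSub

namespace SFExpr

theorem sub_concat {m : M} {Γ Δ Ξ : SCtx m} (t : SFExpr Ξ) (σ : SFSub Δ Ξ) (τ : SFSub Γ Δ) :
    t.sub (σ.concat τ) = (t.sub σ).sub τ := by
  induction τ with
  | id => rw [SFSub.concat, sub]
  | snoc τ ρ ih => rw [SFSub.concat, sub, sub, ih]

theorem asub_pi {m n : M} {Γ : SCtx n} {μ : m ⟶ n} (t : SFExpr Γ) :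
    t.asub (.pi : ASub (Γ.ext μ) Γ) = t.sren .weak := by
  rw [asub_eq_ssub, ARenSub.pi, SSub.ofASub_weaken, ← ssub_sren, SSub.ofASub_id, ssub_id]

theorem asub_key {m n : M} {Γ : SCtx m} {Θ Ψ : LockTele n m} (α : Θ.locks ⟶ Ψ.locks)
    (t : SFExpr (Γ.addLocks Θ)) : t.asub (.key Γ Θ Ψ α) = t.sren (.key Γ Θ Ψ α) := by
  rw [asub_eq_ssub, SSub.ofASub_key, ssub_ofRen]

theorem asub_lock {m n : M} {Γ Δ : SCtx n} {μ : m ⟶ n} (t : SFExpr (Δ.lock μ)) (σ : ASub Γ Δ) :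
    t.asub (σ.lock μ) = t.ssub ((SSub.ofASub σ).lock μ) := by
  rw [asub_eq_ssub, SSub.ofASub_lock]

theorem asub_extend_id {m n : M} {Γ : SCtx n} {μ : m ⟶ n} (t : SFExpr (Γ.ext μ))
    (s : SFExpr (Γ.lock μ)) : t.asub (.extend .id s) = t.ssub ((SSub.id Γ).extend s) := by
  rw [asub_eq_ssub, SSub.ofASub_extend, SSub.ofASub_id]

theorem sub_lock {m n : M} {Γ Δ : SCtx n} {μ : m ⟶ n} (t : SFExpr (Δ.lock μ)) (σ : SFSub Γ Δ) :
    t.sub (σ.lock μ) = t.ssub ((SSub.ofSFSub σ).lock μ) := by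
  rw [sub_eq_ssub, SSub.ofSFSub_lock]

theorem sub_lift {m n : M} {Γ Δ : SCtx n} {μ : m ⟶ n} (t : SFExpr (Δ.ext μ)) (σ : SFSub Γ Δ) :
    t.sub (σ.lift μ) = t.ssub ((SSub.ofSFSub σ).lift μ) := by
  rw [sub_eq_ssub, SSub.ofSFSub_lift]

theorem sren_weak_sub_lift {m n : M} {Γ Δ : SCtx n} {μ : m ⟶ n} (t : SFExpr Δ) (σ : SFSub Γ Δ) :
    (t.sren .weak).sub (σ.lift μ) = (t.sub σ).sren .weak := by
  rw [sub_lift, sren_ssub, SSub.weak_renComp_lift, sub_eq_ssub, ssub_sren]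

theorem sren_weak_asub_extend {m n : M} {Γ : SCtx n} {μ : m ⟶ n} (t : SFExpr Γ)
    (s : SFExpr (Γ.lock μ)) : (t.sren .weak).asub (.extend .id s) = t := by
  rw [asub_extend_id, sren_ssub, SSub.weak_renComp_extend, ssub_id]

/-- The substitution lemma for the instantiation of the last variable. -/
theorem sub_lift_asub_extend {m n : M} {Γ Δ : SCtx n} {μ : m ⟶ n} (t : SFExpr (Δ.ext μ))
    (s : SFExpr (Δ.lock μ)) (σ : SFSub Γ Δ) :
    (t.sub (σ.lift μ)).asub (.extend .id (s.sub (σ.lock μ))) = (t.asub (.extend .id s)).sub σ := by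
  rw [sub_lift, asub_extend_id, ssub_ssub, sub_lock,
    (SSub.isNatural_ofSFSub σ).lift_comp_extend, ← ssub_ssub, asub_extend_id, sub_eq_ssub]

/-- Weakening below the last variable, followed by instantiation with the last variable, is the
identity. -/
theorem asub_pi_lift_asub_extend {m n : M} {Γ : SCtx n} {μ : m ⟶ n} (t : SFExpr (Γ.ext μ)) :
    (t.asub ((ARenSub.pi (μ := μ)).lift (fun _ _ Γ μ => .var (.zeroOne Γ μ)) μ)).asub
      (.extend .id (.var (.zeroOne Γ μ))) = t := by
  have h : SSub.ofASub (ARenSub.pi (Γ := Γ) (μ := μ)) = SSub.ofRen .weak := by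
    rw [ARenSub.pi, SSub.ofASub_weaken, SSub.ofASub_id, SSub.id_compRen]
  rw [asub_eq_ssub t, SSub.ofASub_lift, h, SSub.lift_ofRen, ssub_ofRen, asub_extend_id, sren_ssub,
    SSub.weak_lift_renComp_extend, ssub_id]

end SFExpr

/-! ### Soundness of the rules of σ-equivalence -/

namespace SFSub

theorem lift_concat {m n : M} {Γ Δ Ξ : SCtx n} (σ : SFSub Δ Ξ) (τ : SFSub Γ Δ) (μ : m ⟶ n) :
    (σ.concat τ).lift μ = (σ.lift μ).concat (τ.lift μ) := by
  induction τ with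
  | id => rw [concat, lift, concat]
  | snoc τ ρ ih => rw [concat, lift, lift, concat, ih]

theorem lock_concat {m n : M} {Γ Δ Ξ : SCtx n} (σ : SFSub Δ Ξ) (τ : SFSub Γ Δ) (μ : m ⟶ n) :
    (σ.concat τ).lock μ = (σ.lock μ).concat (τ.lock μ) := by
  induction τ with
  | id => rw [concat, lock, concat]
  | snoc τ ρ ih => rw [concat, lock, lock, concat, ih]

/-- `σ.Λ`: all locks of a lock telescope applied to a substitution. -/
def addLocks {m : M} : {n : M} → {Γ Δ : SCtx n} → SFSub Γ Δ → (Λ : LockTele m n) →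
    SFSub (Γ.addLocks Λ) (Δ.addLocks Λ)
  | _, _, _, σ, .nil => σ
  | _, _, _, σ, .cons μ Λ => (σ.lock μ).addLocks Λ

end SFSub

theorem SSub.ofSFSub_addLocks {m : M} : {n : M} → {Γ Δ : SCtx n} → (σ : SFSub Γ Δ) →
    (Λ : LockTele m n) → ofSFSub (σ.addLocks Λ) = (ofSFSub σ).addLocks Λ
  | _, _, _, _, .nil => rfl
  | _, _, _, σ, .cons μ Λ => by
    rw [SFSub.addLocks]
    exact (ofSFSub_addLocks (σ.lock μ) Λ).trans (congrArg (SSub.addLocks · Λ) (ofSFSub_lock σ μ))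

namespace SFExpr

theorem zeroOne_sub_lift_lock {m n : M} {Γ Δ : SCtx n} (σ : SFSub Γ Δ) (μ : m ⟶ n) :
    (var (.zeroOne Δ μ)).sub ((σ.lift μ).lock μ) = var (.zeroOne Γ μ) := by
  rw [sub_lock, SSub.ofSFSub_lift]
  rfl

theorem zeroOne_asub_extend_lock {m n : M} {Γ Δ : SCtx n} {μ : m ⟶ n} (σ : ASub Γ Δ)
    (t : SFExpr (Γ.lock μ)) :
    (var (.zeroOne Δ μ)).asub ((ARenSub.extend σ t).lock μ) = t := by
  have h : LockTele.fromSingle (Λ := .single μ) (eqToHom (LockTele.locks_single μ).symm) =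
      𝟙 (LockTele.single μ).locks := by
    simp [LockTele.fromSingle]
  rw [asub_lock, SSub.ofASub_extend]
  exact (congrArg (sren (Δ := Γ.addLocks (.single μ)) t)
    ((congrArg (SRen.key Γ (.single μ) (.single μ)) h).trans (SRen.key_id Γ (.single μ)))).trans
    (sren_id (Γ := Γ.addLocks (.single μ)) t)

end SFExpr

/-- The contexts `·.Λ` have no variables, so substitutions into `·` have nothing to differ on. -/
theorem obsEq_empty {m : M} {Γ : SCtx m} (σ τ : SFSub Γ .empty) : ObsEq σ τ := by
  have h : SSub.ofSFSub σ = SSub.ofSFSub τ := by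
    funext k Λ x
    exact nomatch x
  intro t
  rw [SFExpr.sub_eq_ssub, SFExpr.sub_eq_ssub, h]

namespace ObsEq

/-- The application of a substitution to `mod μ t` applies the locked substitution to `t`, so locks
preserve observational equivalence by injectivity of the constructor. -/
theorem lock {m n : M} {Γ Δ : SCtx n} {σ τ : SFSub Γ Δ} (h : ObsEq σ τ) (μ : m ⟶ n) :
    ObsEq (σ.lock μ) (τ.lock μ) := by
  intro t
  have := h (.modTm μ t)
  simpa only [SFExpr.sub_eq_ssub, SSub.ofSFSub_lock, SFExpr.ssub, SFExpr.modTm.injEq, heq_eq_eq,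
    true_and] using this

/-- As for locks, with `λ` in place of `mod`. -/
theorem lift {m n : M} {Γ Δ : SCtx n} {σ τ : SFSub Γ Δ} (h : ObsEq σ τ) (μ : m ⟶ n) :
    ObsEq (σ.lift μ) (τ.lift μ) := by
  intro t
  have := h (.lam μ t)
  simpa only [SFExpr.sub_eq_ssub, SSub.ofSFSub_lift, SFExpr.ssub, SFExpr.lam.injEq, heq_eq_eq,
    true_and] using this

end ObsEq

namespace WSub

/-- The two ways to lift a substitution, `(σ ∘ π) . v₀` on the one side and member by member on the
other, act in the same way. -/
theorem ssub_translate_lift {m n : M} {Γ Δ : SCtx n} {μ : m ⟶ n} (t : SFExpr (Δ.ext μ))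
    (σ : WSub Γ Δ) :
    t.ssub (.ofSFSub (σ.lift μ).translate) = t.ssub ((SSub.ofSFSub σ.translate).lift μ) := by
  rw [← SFExpr.sub_eq_ssub, ← SFExpr.sub_lift]
  simp only [lift, translate, WExpr.translate, SFExpr.sub, SFSub.lift_concat, SFExpr.sub_concat,
    SFSub.atom, SFSub.lift, SFExpr.asub_pi_lift_asub_extend]

theorem translate_addLocks {m : M} : {n : M} → {Γ Δ : SCtx n} → (σ : WSub Γ Δ) →
    (Λ : LockTele m n) → (σ.addLocks Λ).translate = σ.translate.addLocks Λ
  | _, _, _, _, .nil => rfl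
  | _, _, _, σ, .cons μ Λ => by
    refine (translate_addLocks (σ.lock μ) Λ).trans ?_
    rw [translate, SFSub.addLocks]

/-- Transporting a substitution along equalities of contexts amounts to composing it with the
corresponding renamings. -/
theorem sub_translate_cast {m : M} {Γ Γ' Δ Δ' : SCtx m} (hΓ : Γ = Γ') (hΔ : Δ = Δ')
    (σ : WSub Γ Δ) (t : SFExpr Δ') :
    t.sub (σ.cast hΓ hΔ).translate =
      ((t.sren (SRen.ofEq hΔ)).sub σ.translate).sren (SRen.ofEq hΓ.symm) := by
  subst hΓ hΔ
  exact ((SFExpr.sren_id _).trans (congrArg (SFExpr.sub · σ.translate) (SFExpr.sren_id t))).symm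

theorem obsEq_translate_key_natural {m n : M} {Γ Δ : SCtx m} (Λ Θ : LockTele n m)
    (α : Λ.locks ⟶ Θ.locks) (σ : WSub Γ Δ) :
    ObsEq ((key Δ Λ Θ α).comp (σ.addLocks Θ)).translate
      ((σ.addLocks Λ).comp (key Γ Λ Θ α)).translate := by
  intro t
  simp only [translate, translate_addLocks, SFExpr.sub_concat, SFSub.atom, SFExpr.sub,
    SFExpr.asub_key]
  rw [SFExpr.sub_eq_ssub, SFExpr.sub_eq_ssub, SSub.ofSFSub_addLocks, SSub.ofSFSub_addLocks,
    (SSub.isNatural_ofSFSub _).ssub_key]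

theorem obsEq_translate_key_horiz {m n o : M} (Γ : SCtx m) (Θ₁ Θ₂ : LockTele o n)
    (Λ₁ Λ₂ : LockTele n m) (α : Θ₁.locks ⟶ Θ₂.locks) (β : Λ₁.locks ⟶ Λ₂.locks) :
    ObsEq
      ((key Γ (Λ₁.append Θ₁) (Λ₂.append Θ₂) (LockTele.hcomp β α)).cast
        (Γ.addLocks_append Λ₂ Θ₂) (Γ.addLocks_append Λ₁ Θ₁)).translate
      (((key Γ Λ₁ Λ₂ β).addLocks Θ₁).comp (key (Γ.addLocks Λ₂) Θ₁ Θ₂ α)).translate := by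
  intro t
  have h : SSub.ofSFSub (SFSub.atom (.key Γ Λ₁ Λ₂ β)) = SSub.ofRen (SRen.key Γ Λ₁ Λ₂ β) := by
    funext k Λ x
    rw [SFSub.atom, SSub.ofSFSub, SSub.ofSFSub, SSub.ofASub_key]
    exact SSub.addLocks_flat _ Λ x
  rw [sub_translate_cast]
  simp only [translate, translate_addLocks, SFExpr.sub_concat]
  rw [SFExpr.sub_eq_ssub _ (SFSub.addLocks _ _), SSub.ofSFSub_addLocks, h, SSub.addLocks_ofRen,
    SFExpr.ssub_ofRen, SFSub.atom, SFSub.atom]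
  simp only [SFExpr.sub, SFExpr.asub_key]
  rw [SFExpr.sren_sren, SFExpr.sren_sren, SRen.key_hcomp, SFExpr.sren_sren]
  exact congrArg (fun ρ => t.sren (ρ.comp (((SRen.key Γ Λ₁ Λ₂ β).addLocks Θ₁).comp
    (SRen.key (Γ.addLocks Λ₂) Θ₁ Θ₂ α))))
    (SRen.ofEq_comp_ofEq_symm (Γ.addLocks_append Λ₁ Θ₁))

end WSub

mutual

/-- σ-equivalent expressions have the same translation. -/
theorem EqExpr.translate_eq : {m : M} → {Γ : SCtx m} → {t s : WExpr Γ} → EqExpr t s →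
    t.translate = s.translate
  | _, _, _, _, .refl _ => rfl
  | _, _, _, _, .symm h => h.translate_eq.symm
  | _, _, _, _, .trans h h' => h.translate_eq.trans h'.translate_eq
  | _, _, _, _, .sub_id t => by simp only [WExpr.translate, WSub.translate, SFExpr.sub]
  | _, _, _, _, .sub_comp t σ τ => by
    simp only [WExpr.translate, WSub.translate, SFExpr.sub_concat]
  | _, _, _, _, .cong_arrow μ hT hS => by
    simp only [WExpr.translate, hT.translate_eq, hS.translate_eq]
  | _, _, _, _, .cong_lam μ h => by simp only [WExpr.translate, h.translate_eq]
  | _, _, _, _, .cong_app μ hf ht => by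
    simp only [WExpr.translate, hf.translate_eq, ht.translate_eq]
  | _, _, _, _, .cong_sub ht hσ => by
    simp only [WExpr.translate, ht.translate_eq, hσ.translate_obsEq _]
  | _, _, _, _, .cong_ite hA hs ht ht' => by
    simp only [WExpr.translate, hA.translate_eq, hs.translate_eq, ht.translate_eq,
      ht'.translate_eq]
  | _, _, _, _, .cong_modTy μ h => by simp only [WExpr.translate, h.translate_eq]
  | _, _, _, _, .cong_modTm μ h => by simp only [WExpr.translate, h.translate_eq]
  | _, _, _, _, .cong_letMod ν μ hA hB ht hs => by
    simp only [WExpr.translate, hA.translate_eq, hB.translate_eq, ht.translate_eq,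
      hs.translate_eq]
  | _, _, _, _, .arrow_sub μ T S σ => by
    simp only [WExpr.translate, WSub.ssub_translate_lift, WSub.translate, SFExpr.sub_eq_ssub,
      SSub.ofSFSub_lock, SFExpr.ssub]
  | _, _, _, _, .lam_sub μ t σ => by
    simp only [WExpr.translate, WSub.ssub_translate_lift, SFExpr.sub_eq_ssub, SFExpr.ssub]
  | _, _, _, _, .app_sub μ f t σ => by
    simp only [WExpr.translate, WSub.translate, SFExpr.sub_eq_ssub, SSub.ofSFSub_lock, SFExpr.ssub]
  | _, _, _, _, .bool_sub σ => by simp only [WExpr.translate, SFExpr.sub_eq_ssub, SFExpr.ssub]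
  | _, _, _, _, .tt_sub σ => by simp only [WExpr.translate, SFExpr.sub_eq_ssub, SFExpr.ssub]
  | _, _, _, _, .ff_sub σ => by simp only [WExpr.translate, SFExpr.sub_eq_ssub, SFExpr.ssub]
  | _, _, _, _, .ite_sub A s t t' σ => by
    simp only [WExpr.translate, WSub.ssub_translate_lift, SFExpr.sub_eq_ssub, SFExpr.ssub]
  | _, _, _, _, .modTy_sub μ A σ => by
    simp only [WExpr.translate, WSub.translate, SFExpr.sub_eq_ssub, SSub.ofSFSub_lock, SFExpr.ssub]
  | _, _, _, _, .modTm_sub μ t σ => by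
    simp only [WExpr.translate, WSub.translate, SFExpr.sub_eq_ssub, SSub.ofSFSub_lock, SFExpr.ssub]
  | _, _, _, _, .letMod_sub ν μ A B t s σ => by
    simp only [WExpr.translate, WSub.ssub_translate_lift, WSub.translate, SFExpr.sub_eq_ssub,
      SSub.ofSFSub_lock, SFExpr.ssub]
  | _, _, _, _, .extend_var μ σ t => by
    simp only [WExpr.translate, WSub.translate, SFSub.lock, SFExpr.sub,
      SFExpr.zeroOne_sub_lift_lock, SFExpr.zeroOne_asub_extend_lock]

/-- σ-equivalent substitutions have observationally equivalent translations. -/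
theorem EqSub.translate_obsEq : {m : M} → {Γ Δ : SCtx m} → {σ τ : WSub Γ Δ} → EqSub σ τ →
    ObsEq σ.translate τ.translate
  | _, _, _, _, _, .refl _ => fun _ => rfl
  | _, _, _, _, _, .symm h => fun t => (h.translate_obsEq t).symm
  | _, _, _, _, _, .trans h h' => fun t => (h.translate_obsEq t).trans (h'.translate_obsEq t)
  | _, _, _, _, _, .id_right σ => fun t => by
    simp only [WSub.translate, SFExpr.sub_concat, SFExpr.sub]
  | _, _, _, _, _, .id_left σ => fun t => by
    simp only [WSub.translate, SFExpr.sub_concat, SFExpr.sub]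
  | _, _, _, _, _, .assoc σ τ ρ => fun t => by
    simp only [WSub.translate, SFExpr.sub_concat]
  | _, _, _, _, _, .cong_comp hσ hτ => fun t => by
    simp only [WSub.translate, SFExpr.sub_concat, hσ.translate_obsEq t, hτ.translate_obsEq _]
  | _, _, _, _, _, .cong_extend μ hσ ht => fun t => by
    simp only [WSub.translate, SFExpr.sub, hσ.translate_obsEq.lift μ t, ht.translate_eq]
  | _, _, _, _, _, .cong_lock μ h => by
    simp only [WSub.translate]
    exact h.translate_obsEq.lock μ
  | _, _, _, _, _, .empty_unique σ => obsEq_empty _ _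
  | _, _, _, _, _, .extend_weaken μ σ t => fun s => by
    simp only [WSub.translate, SFExpr.sub_concat, SFExpr.sub, SFSub.atom, SFExpr.asub_pi,
      SFExpr.sren_weak_sub_lift, SFExpr.sren_weak_asub_extend]
  | _, _, _, _, _, .extend_eta μ σ => fun t => by
    simp only [WSub.translate, WExpr.translate, SFSub.lift_concat, SFExpr.sub_concat, SFExpr.sub,
      SFSub.atom, SFSub.lift, SFExpr.sub_lift_asub_extend, SFExpr.asub_pi_lift_asub_extend]
  | _, _, _, _, _, .lock_id μ => fun t => by simp only [WSub.translate, SFSub.lock]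
  | _, _, _, _, _, .lock_comp μ σ τ => fun t => by
    simp only [WSub.translate, SFSub.lock_concat]
  | _, _, _, _, _, .key_natural Λ Θ α σ => WSub.obsEq_translate_key_natural Λ Θ α σ
  | _, _, _, _, _, .key_unit Γ Λ => fun t => by
    simp only [WSub.translate, SFSub.atom, SFExpr.sub, SFExpr.asub_key, SRen.key_id,
      SFExpr.sren_id]
  | _, _, _, _, _, .key_vert Γ Λ Θ Ψ α β => fun t => by
    simp only [WSub.translate, SFSub.atom, SFExpr.sub, SFExpr.sub_concat, SFExpr.asub_key,
      SFExpr.sren_sren, SRen.key_comp]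
  | _, _, _, _, _, .key_horiz Γ Θ₁ Θ₂ Λ₁ Λ₂ α β =>
    WSub.obsEq_translate_key_horiz Γ Θ₁ Θ₂ Λ₁ Λ₂ α β

end

end

end MTT

theorem mainTheorem1 {M : Type u} [Bicategory.{w, v} M] [Bicategory.Strict M] :
    (∀ {m : M} {Γ : MTT.SCtx m} (t s : MTT.WExpr Γ),
      MTT.EqExpr t s → t.translate = s.translate) ∧
    (∀ {m : M} {Γ Δ : MTT.SCtx m} (σ τ : MTT.WSub Γ Δ),
      MTT.EqSub σ τ → MTT.ObsEq σ.translate τ.translate) :=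
  ⟨fun _ _ h => h.translate_eq, fun _ _ h => h.translate_obsEq⟩
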